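/- All manifolds are smooth, Hausdorff and paracompact, of finite dimension without boundary; $\mathcal F(M)=C^\infty(M)$, and all bundles, sections and maps are smooth. **Generalized Lie algebroid.** Let $F\to N$ be a vector bundle of rank $p$, let $h\colon M\to N$ and $\eta\colon N\to M$ be diffeomorphisms, and let $(\rho,\eta)$ be a vector bundle morphism from $F\to N$ to $TM\to M$. For $u\in\Gamma(F)$ let $\Gamma(Th\circ\rho,h\circ\eta)(u)=(Th\circ\rho)\circ u\circ(h\circ\eta)^{-1}$, a vector field on $N$. A generalized Lie algebroid $((F,\nu,N),[\,,]_{F,h},(\rho,\eta))$ is given by these data together with a biadditive operation $[\,,]_{F,h}$ on $\Gamma(F)$ with $[u,u]_{F,h}=0$, satisfying the Jacobi identity and $$[u,fv]_{F,h}=f[u,v]_{F,h}+\Gamma(Th\circ\rho,h\circ\eta)(u)(f)\,v\qquad(u,v\in\Gamma(F),\ f\in\mathcal F(N)).$$ Its pull-back Lie algebroid is the vector bundle $h^*F\to M$ with the bracket and the anchor determined by $[u\circ h,v\circ h]_{h^*F}=[u,v]_{F,h}\circ h$ and $(u\circ h)(f\circ h)=\big(\Gamma(Th\circ\rho,h\circ\eta)(u)(f)\big)\circ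 h$. For $U\subseteq M$ open it restricts to a bracket on $\Gamma(h^*F|_U)$ and an action of $\Gamma(h^*F|_U)$ on $\mathcal F(U)$ by derivations. **Exterior calculus.** For $U\subseteq M$ open, $\Lambda^q(h^*F|_U)$ is the module of alternating $\mathcal F(U)$-multilinear maps $\Gamma(h^*F|_U)^q\to\mathcal F(U)$; $\Lambda(h^*F|_U)=\bigoplus_{q\ge0}\Lambda^q(h^*F|_U)$, with the wedge product, is the exterior algebra, with the differential $$d\omega(z_0,\dots,z_q)=\sum_{i}(-1)^i z_i\big(\omega(z_0,\dots,\widehat{z_i},\dots,z_q)\big)+\sum_{i<j}(-1)^{i+j}\omega([z_i,z_j]_{h^*F},z_0,\dots,\widehat{z_i},\dots,\widehat{z_j},\dots,z_q).$$ A differential ideal is an ideal $\mathcal I$ of $\Lambda(h^*F|_U)$ with $d\mathcal I\subseteq\mathcal I$. **Systems.** An interior differential system (IDS) is a vector subbundle $E$ of $h^*F\to M$ (its rank may differ on different components of $M$). It is involutive if $[S,T]_{h^*F}\in\Gamma(E)$ for all $S,T\in\Gamma(E)$. The sections over $U$ of its annihilator bundle are $\Gamma(E^0|_U)=\{\Theta\in\Lambda^1(h^*F|_U):\Theta(S)=0\text{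 for all }S\in\Gamma(E|_U)\}$. A differential ideal $\mathcal I$ of $\Lambda(h^*F|_U)$ is an exterior differential system (EDS) over $U$ if there is an IDS $E'$ such that, for all $k\ge1$ and $\omega\in\mathcal I\cap\Lambda^k(h^*F|_U)$, one has $\omega(u_1,\dots,u_k)=0$ for all $u_1,\dots,u_k\in\Gamma(E'|_U)$. **Corollary.** Let $E$ be an IDS of a generalized Lie algebroid, and let $\mathcal A$ be an atlas of $M$, consisting of charts $(U,\xi_U)$ of its smooth structure over whose domains $h^*F$ is trivial. Then $E$ is involutive if and only if, for every $(U,\xi_U)\in\mathcal A$, the ideal of $\Lambda(h^*F|_U)$ generated by $\Gamma(E^0|_U)$ is an EDS over $U$ (in particular it is closed under $d$). -/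

import Mathlib

/-- A generalized Lie algebra over a commutative ring `R` of functions: an `R`-module with a
biadditive alternating bracket satisfying the Jacobi identity, and a module morphism to the
(additive) derivations of `R` for which the Leibniz rule holds. -/
structure GenLieAlgebra (R A : Type*) [CommRing R] [AddCommGroup A] [Module R A] where
  anchor : A →ₗ[R] Derivation ℤ R R
  bracket : A → A → A
  add_bracket : ∀ u v w, bracket (u + v) w = bracket u w + bracket v w
  bracket_add : ∀ u v w, bracket u (v + w) = bracket u v + bracket u w
  bracket_self : ∀ u, bracket u u = 0
  jacobi : ∀ u v w, bracket u (bracket v w) + bracket w (bracket u v) + bracket v (bracket w u) = 0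
  leibniz : ∀ (u : A) (f : R) (v : A), bracket u (f • v) = f • bracket u v + anchor u f • v

namespace GenLieAlgebra

variable {R A : Type*} [CommRing R] [AddCommGroup A] [Module R A]

theorem bracket_swap (L : GenLieAlgebra R A) (u v : A) : L.bracket u v = -L.bracket v u := by
  have h := L.bracket_self (u + v)
  rw [L.add_bracket, L.bracket_add, L.bracket_add, L.bracket_self, L.bracket_self, zero_add,
    add_zero] at h
  exact eq_neg_of_add_eq_zero_left h

theorem smul_bracket (L : GenLieAlgebra R A) (f : R) (u v : A) :
    L.bracket (f • u) v = f • L.bracket u v - L.anchor v f • u := by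
  rw [L.bracket_swap, L.leibniz, L.bracket_swap u v, smul_neg]
  abel

/-- The terms of the exterior derivative which contain the anchor. -/
def koszulAnchor (L : GenLieAlgebra R A) {q : ℕ} (ω : A [⋀^Fin q]→ₗ[R] R)
    (z : Fin (q + 1) → A) : R :=
  ∑ i : Fin (q + 1), (-1) ^ (i : ℕ) * L.anchor (z i) (ω (i.removeNth z))

/-- The terms of the exterior derivative which contain the bracket. The summand `(i, j)` belongs to
the pair of positions `i < j + 1` of `z`. -/
def koszulBracket (L : GenLieAlgebra R A) :
    {q : ℕ} → (A [⋀^Fin q]→ₗ[R] R) → (Fin (q + 1) → A) → R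
  | 0, _, _ => 0
  | q + 1, ω, z => ∑ i : Fin (q + 1), ∑ j ∈ Finset.Ici i, (-1) ^ ((i : ℕ) + ((j : ℕ) + 1)) *
      ω (Matrix.vecCons (L.bracket (z i.castSucc) (z j.succ))
        (j.removeNth (i.castSucc.removeNth z)))

/-- The formula for the exterior derivative of `ω`, evaluated on `z 0, …, z q`:
`∑ i, (-1)^i ρ(z i)(ω(…, ẑ i, …)) + ∑ i < j, (-1)^(i+j) ω([z i, z j], …, ẑ i, …, ẑ j, …)`. -/
def koszul (L : GenLieAlgebra R A) {q : ℕ} (ω : A [⋀^Fin q]→ₗ[R] R)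
    (z : Fin (q + 1) → A) : R :=
  L.koszulAnchor ω z + L.koszulBracket ω z

theorem removeNth_succ_cons {X : Type*} {q : ℕ} (a : X) (z : Fin (q + 1) → X)
    (i : Fin (q + 1)) :
    i.succ.removeNth (Fin.cons a z : Fin (q + 2) → X) = Fin.cons a (i.removeNth z) := by
  funext k
  refine Fin.cases ?_ (fun k => ?_) k <;> simp [Fin.removeNth]

theorem map_update_eq {q : ℕ} (ω : A [⋀^Fin (q + 1)]→ₗ[R] R) (z : Fin (q + 1) → A)
    (j : Fin (q + 1)) (x : A) :
    ω (Function.update z j x) = (-1) ^ (j : ℕ) * ω (Fin.cons x (j.removeNth z)) := by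
  have := ω.map_insertNth j x (j.removeNth z)
  rw [Fin.insertNth_removeNth] at this
  rw [this]
  simp [Matrix.vecCons]

theorem koszulAnchor_cons (L : GenLieAlgebra R A) {q : ℕ} (ω : A [⋀^Fin (q + 1)]→ₗ[R] R)
    (a : A) (z : Fin (q + 1) → A) :
    L.koszulAnchor ω (Fin.cons a z : Fin (q + 2) → A) =
      L.anchor a (ω z) - L.koszulAnchor (ω.curryLeft a) z := by
  rw [koszulAnchor, Fin.sum_univ_succ, koszulAnchor, sub_eq_add_neg, ← Finset.sum_neg_distrib]
  congr 1
  · simp [Fin.removeNth_zero]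
  · refine Finset.sum_congr rfl fun i _ => ?_
    rw [removeNth_succ_cons]
    simp [pow_succ, Matrix.vecCons]

theorem koszulBracket_cons (L : GenLieAlgebra R A) : ∀ {q : ℕ} (ω : A [⋀^Fin (q + 1)]→ₗ[R] R)
    (a : A) (z : Fin (q + 1) → A),
    L.koszulBracket ω (Fin.cons a z : Fin (q + 2) → A) =
      -∑ j, ω (Function.update z j (L.bracket a (z j))) - L.koszulBracket (ω.curryLeft a) z := by
  have key : ∀ {q : ℕ} (ω : A [⋀^Fin (q + 1)]→ₗ[R] R) (a : A) (z : Fin (q + 1) → A),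
      ∑ j ∈ Finset.Ici (0 : Fin (q + 1)), (-1) ^ (((0 : Fin (q + 1)) : ℕ) + ((j : ℕ) + 1)) *
      ω (Matrix.vecCons (L.bracket ((Fin.cons a z : Fin (q + 2) → A) (Fin.castSucc 0))
        ((Fin.cons a z : Fin (q + 2) → A) j.succ))
        (j.removeNth ((Fin.castSucc 0).removeNth (Fin.cons a z : Fin (q + 2) → A)))) =
      -∑ j, ω (Function.update z j (L.bracket a (z j))) := by
    intro q ω a z
    rw [← Finset.sum_neg_distrib]
    have : Finset.Ici (0 : Fin (q + 1)) = Finset.univ := by ext; simp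
    rw [this]
    refine Finset.sum_congr rfl fun j _ => ?_
    rw [map_update_eq]
    simp [pow_succ, Matrix.vecCons, Fin.removeNth_zero]
  intro q ω a z
  cases q with
  | zero =>
    have h := key ω a z
    have h0 : L.koszulBracket (ω.curryLeft a) z = 0 := rfl
    rw [h0, sub_zero]
    exact Eq.trans (Fin.sum_univ_one _) h
  | succ q =>
    rw [koszulBracket, Fin.sum_univ_succ, key, koszulBracket, sub_eq_add_neg]
    congr 1
    rw [← Finset.sum_neg_distrib]
    refine Finset.sum_congr rfl fun i _ => ?_
    rw [← Finset.sum_neg_distrib]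
    have : Finset.Ici i.succ = (Finset.Ici i).map (Fin.succEmb _) := by
      simp
    rw [this, Finset.sum_map]
    refine Finset.sum_congr rfl fun j _ => ?_
    have hsw : ∀ (x : A) (w : Fin q → A),
        ω (Fin.cons x (Fin.cons a w : Fin (q + 1) → A) : Fin (q + 2) → A) =
        - ω (Fin.cons a (Fin.cons x w : Fin (q + 1) → A) : Fin (q + 2) → A) := by
      intro x w
      rw [← ω.map_swap _ (show (0 : Fin (q + 2)) ≠ 1 by simp)]
      congr 1
      funext k
      refine Fin.cases ?_ (fun k => Fin.cases ?_ (fun k => ?_) k) k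
      · simp
      · simp
      · have h0 : (k.succ.succ : Fin (q + 2)) ≠ 0 := Fin.succ_ne_zero _
        have h1 : (k.succ.succ : Fin (q + 2)) ≠ 1 := by
          rw [← Fin.succ_zero_eq_one]; exact fun h => Fin.succ_ne_zero _ (Fin.succ_injective _ h)
        simp [Equiv.swap_apply_of_ne_of_ne h0 h1]
    simp only [Fin.castSucc_succ, removeNth_succ_cons, Fin.cons_succ, Fin.coe_succEmb,
      Matrix.vecCons, AlternatingMap.curryLeft_apply_apply, Fin.val_succ]
    rw [hsw]
    ring

theorem koszul_cons (L : GenLieAlgebra R A) {q : ℕ} (ω : A [⋀^Fin (q + 1)]→ₗ[R] R)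
    (a : A) (z : Fin (q + 1) → A) :
    L.koszul ω (Fin.cons a z : Fin (q + 2) → A) =
      L.anchor a (ω z) - ∑ j, ω (Function.update z j (L.bracket a (z j))) -
        L.koszul (ω.curryLeft a) z := by
  rw [koszul, koszulAnchor_cons, koszulBracket_cons, koszul]
  ring

theorem koszul_add (L : GenLieAlgebra R A) {q : ℕ} (ω θ : A [⋀^Fin q]→ₗ[R] R)
    (z : Fin (q + 1) → A) : L.koszul (ω + θ) z = L.koszul ω z + L.koszul θ z := by
  cases q <;> simp only [koszul, koszulAnchor, koszulBracket, AlternatingMap.add_apply, map_add,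
    mul_add, Finset.sum_add_distrib] <;> ring

theorem koszul_smul (L : GenLieAlgebra R A) {q : ℕ} (f : R) (ω : A [⋀^Fin q]→ₗ[R] R)
    (z : Fin (q + 1) → A) : L.koszul (f • ω) z = f * L.koszul ω z +
      ∑ i : Fin (q + 1), (-1) ^ (i : ℕ) * (L.anchor (z i) f * ω (i.removeNth z)) := by
  cases q <;> simp only [koszul, koszulAnchor, koszulBracket, AlternatingMap.smul_apply,
    smul_eq_mul, Derivation.leibniz, mul_add, Finset.sum_add_distrib, Finset.mul_sum,
    mul_left_comm f, mul_comm (ω _) (L.anchor _ _)] <;> ring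


theorem exists_koszul (L : GenLieAlgebra R A) : ∀ {q : ℕ} (ω : A [⋀^Fin q]→ₗ[R] R),
    ∃ D : A [⋀^Fin (q + 1)]→ₗ[R] R, ∀ z, D z = L.koszul ω z := by
  intro q
  induction q with
  | zero =>
    intro ω
    refine ⟨AlternatingMap.ofSubsingleton R A R (0 : Fin 1)
      { toFun := fun a => L.anchor a (ω ![])
        map_add' := fun a b => by simp
        map_smul' := fun f a => by simp }, fun z => ?_⟩
    have : (0 : Fin 1).removeNth z = ![] := Subsingleton.elim _ _
    simp [koszul, koszulAnchor, koszulBracket, this]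
  | succ q ih =>
    intro ω
    choose D hD using @ih
    -- evaluation with separated first argument
    have hc : ∀ z : Fin (q + 2) → A, L.koszul ω z = L.anchor (z 0) (ω (Fin.tail z)) -
        ∑ j, ω (Function.update (Fin.tail z) j (L.bracket (z 0) (Fin.tail z j))) -
          D (ω.curryLeft (z 0)) (Fin.tail z) := by
      intro z
      rw [hD, ← koszul_cons, Fin.cons_self_tail]
    have hDadd : ∀ (θ₁ θ₂ : A [⋀^Fin q]→ₗ[R] R) z, D (θ₁ + θ₂) z = D θ₁ z + D θ₂ z := by
      intro θ₁ θ₂ z; simp only [hD, koszul_add]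
    have hmul : ∃ Dm : MultilinearMap R (fun _ : Fin (q + 2) => A) R, ∀ z, Dm z = L.koszul ω z := by
      refine ⟨MultilinearMap.mk' (L.koszul ω) ?_ ?_, fun _ => rfl⟩
      · intro z k x y
        refine Fin.cases ?_ (fun k => ?_) k
        · simp only [hc, Fin.tail_update_zero, Function.update_self, map_add, hDadd,
            L.add_bracket, AlternatingMap.map_update_add, Finset.sum_add_distrib,
            Derivation.add_apply]
          ring
        · have h0 : ∀ x : A, Function.update z k.succ x 0 = z 0 := fun x =>
            Function.update_of_ne (Fin.succ_ne_zero k).symm _ _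
          have key : ∀ j, ω (Function.update (Function.update (Fin.tail z) k (x + y)) j
              (L.bracket (z 0) (Function.update (Fin.tail z) k (x + y) j))) =
              ω (Function.update (Function.update (Fin.tail z) k x) j
              (L.bracket (z 0) (Function.update (Fin.tail z) k x j))) +
              ω (Function.update (Function.update (Fin.tail z) k y) j
              (L.bracket (z 0) (Function.update (Fin.tail z) k y j))) := by
            intro j
            rcases eq_or_ne j k with rfl | hjk
            · simp [L.bracket_add]
            · simp [Function.update_of_ne hjk, Function.update_comm hjk.symm]
          simp only [hc, Fin.tail_update_succ, h0, key, AlternatingMap.map_update_add, map_add,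
            Finset.sum_add_distrib]
          ring
      · intro z k f x
        refine Fin.cases ?_ (fun k => ?_) k
        · have hs : ∀ z', D (f • ω.curryLeft x) z' = f * D (ω.curryLeft x) z' +
              ∑ j : Fin (q + 1), L.anchor (z' j) f * ω (Function.update z' j x) := by
            intro z'
            rw [hD, koszul_smul, hD]
            congr 1
            refine Finset.sum_congr rfl fun j _ => ?_
            rw [map_update_eq]
            simp only [AlternatingMap.curryLeft_apply_apply, Matrix.vecCons]
            ring
          simp only [hc, Fin.tail_update_zero, Function.update_self, map_smul, hs, L.smul_bracket,
            AlternatingMap.map_update_sub, AlternatingMap.map_update_smul,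
            Finset.sum_sub_distrib, Derivation.smul_apply, smul_eq_mul, mul_sub, Finset.mul_sum]
          ring
        · have h0 : ∀ x : A, Function.update z k.succ x 0 = z 0 := fun x =>
            Function.update_of_ne (Fin.succ_ne_zero k).symm _ _
          have key : ∀ j, ω (Function.update (Function.update (Fin.tail z) k (f • x)) j
              (L.bracket (z 0) (Function.update (Fin.tail z) k (f • x) j))) =
              f * ω (Function.update (Function.update (Fin.tail z) k x) j
              (L.bracket (z 0) (Function.update (Fin.tail z) k x j))) +
              if j = k then L.anchor (z 0) f * ω (Function.update (Fin.tail z) k x) else 0 := by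
            intro j
            rcases eq_or_ne j k with rfl | hjk
            · simp [L.leibniz]
            · simp [Function.update_comm hjk.symm, hjk]
          simp only [hc, Fin.tail_update_succ, h0, key, AlternatingMap.map_update_smul,
            Finset.sum_add_distrib, Finset.sum_ite_eq', Finset.mem_univ, if_true, smul_eq_mul,
            Derivation.leibniz, mul_sub, Finset.mul_sum]
          ring
    obtain ⟨Dm, hDm⟩ := hmul
    -- alternation among the positions `≥ 1`
    have alt1 : ∀ (z : Fin (q + 2) → A) (k l : Fin (q + 1)), k ≠ l → z k.succ = z l.succ →
        Dm z = 0 := by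
      intro z k l hkl hz
      have hz' : Fin.tail z k = Fin.tail z l := hz
      rw [hDm, hc, ω.map_eq_zero_of_eq _ hz' hkl, (D _).map_eq_zero_of_eq _ hz' hkl, map_zero,
        sub_zero, zero_sub, neg_eq_zero]
      rw [Finset.sum_eq_add k l hkl]
      · rw [← hz', add_comm]
        have : Function.update (Fin.tail z) k (L.bracket (z 0) (Fin.tail z k)) =
            Function.update (Fin.tail z) l (L.bracket (z 0) (Fin.tail z k)) ∘ Equiv.swap k l := by
          funext i
          rcases eq_or_ne i k with rfl | hik
          · simp
          rcases eq_or_ne i l with rfl | hil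
          · simp [Function.update_of_ne hik, Function.update_of_ne hkl, hz']
          · simp [Equiv.swap_apply_of_ne_of_ne hik hil, hik, hil]
        rw [this, ω.map_swap _ hkl]
        ring
      · intro j _ ⟨hjk, hjl⟩
        refine ω.map_eq_zero_of_eq _ (i := k) (j := l) ?_ hkl
        rw [Function.update_of_ne hjk.symm, Function.update_of_ne hjl.symm, hz']
      · simp
      · simp
    -- positions `0` and `1`
    have alt2 : ∀ (z : Fin (q + 2) → A), z 0 = z 1 → Dm z = 0 := by
      intro z hz
      have hdec : Fin.tail z = Fin.cons (z 0) (Fin.tail (Fin.tail z)) := by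
        rw [hz]; exact (Fin.cons_self_tail (Fin.tail z)).symm
      rw [hDm, ← Fin.cons_self_tail z, koszul_cons, hdec]
      generalize Fin.tail (Fin.tail z) = w
      generalize z 0 = a
      clear hdec hz hc
      rw [Fin.sum_univ_succ]
      simp only [Fin.cons_zero, Fin.cons_succ, L.bracket_self, Fin.update_cons_zero,
        ← Fin.cons_update]
      have h1 : ω (Fin.cons 0 w) = 0 := ω.map_coord_zero 0 (by simp)
      rw [h1, zero_add]
      cases q with
      | zero =>
        have : (0 : Fin 1).removeNth (Fin.cons a w : Fin 1 → A) = w := Subsingleton.elim _ _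
        simp [koszul, koszulAnchor, koszulBracket, this, Matrix.vecCons]
      | succ q =>
        rw [koszul_cons]
        have h2 : (ω.curryLeft a).curryLeft a = 0 := ω.curryLeft_same a
        have h3 : L.koszul (0 : A [⋀^Fin q]→ₗ[R] R) w = 0 := by
          have := L.koszul_add (0 : A [⋀^Fin q]→ₗ[R] R) 0 w
          simpa using this
        rw [h2, h3]
        simp [Matrix.vecCons]
    -- positions `0` and `k + 1`
    have alt3 : ∀ (z : Fin (q + 2) → A) (k : Fin (q + 1)), z 0 = z k.succ → Dm z = 0 := by
      intro z k hz
      rcases eq_or_ne k 0 with rfl | hk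
      · exact alt2 z hz
      let N : A [⋀^Fin (q + 1)]→ₗ[R] R :=
        { Dm.curryLeft (z 0) with
          map_eq_zero_of_eq' := fun w i j hw hij =>
            alt1 (Fin.cons (z 0) w) i j hij (by simpa using hw) }
      have hN : ∀ w, N w = Dm (Fin.cons (z 0) w) := fun w => rfl
      have h1 : Dm z = N (Fin.tail z) := by rw [hN, Fin.cons_self_tail]
      have h2 := N.map_swap (Fin.tail z) hk
      have h3 : N (Fin.tail z ∘ Equiv.swap k 0) = 0 := by
        rw [hN]
        refine alt2 _ ?_
        have : (1 : Fin (q + 2)) = Fin.succ 0 := rfl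
        rw [this]
        simp [Fin.tail, hz]
      rw [h1, ← neg_eq_zero, ← h2, h3]
    refine ⟨{ Dm with map_eq_zero_of_eq' := ?_ }, hDm⟩
    intro z i j
    refine Fin.cases ?_ (fun i => ?_) i <;> refine Fin.cases ?_ (fun j => ?_) j
    · intro _ h; exact absurd rfl h
    · intro h _; exact alt3 z j h
    · intro h _; exact alt3 z i h.symm
    · intro h hij; exact alt1 z i j (fun h' => hij (by rw [h'])) h

end GenLieAlgebra

namespace GenLieAlgebra

variable {R A : Type*} [CommRing R] [AddCommGroup A] [Module R A]

/-- The exterior derivative of a `q`-form. -/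
def extDer (L : GenLieAlgebra R A) {q : ℕ} (ω : A [⋀^Fin q]→ₗ[R] R) :
    A [⋀^Fin (q + 1)]→ₗ[R] R where
  toFun z := L.koszul ω z
  map_update_add' z k x y := by
    obtain ⟨D, hD⟩ := L.exists_koszul ω
    simp only [← hD]
    exact D.toMultilinearMap.map_update_add' z k x y
  map_update_smul' z k f x := by
    obtain ⟨D, hD⟩ := L.exists_koszul ω
    simp only [← hD]
    exact D.toMultilinearMap.map_update_smul' z k f x
  map_eq_zero_of_eq' z i j h hij := by
    obtain ⟨D, hD⟩ := L.exists_koszul ω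
    simp only [← hD]
    exact D.map_eq_zero_of_eq z h hij

end GenLieAlgebra

section Forms

variable (R A : Type*) [CommRing R] [AddCommGroup A] [Module R A]

/-- The exterior algebra: the direct sum of the modules of alternating `q`-forms on `A`. -/
abbrev ExtForms : Type _ := DirectSum ℕ fun q => A [⋀^Fin q]→ₗ[R] R

variable {R A}

/-- The wedge product of a `q`-form and an `r`-form, the sum over shuffles of signed products. -/
def wedgeForm (q r : ℕ) :
    (A [⋀^Fin q]→ₗ[R] R) →ₗ[R] (A [⋀^Fin r]→ₗ[R] R) →ₗ[R] (A [⋀^Fin (q + r)]→ₗ[R] R) :=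
  (TensorProduct.mk R (A [⋀^Fin q]→ₗ[R] R) (A [⋀^Fin r]→ₗ[R] R)).compr₂
    ((AlternatingMap.domDomCongrₗ R finSumFinEquiv).toLinearMap ∘ₗ
      (LinearMap.mul' R R).compAlternatingMapₗ R ∘ₗ AlternatingMap.domCoprod')

theorem wedgeForm_apply {q r : ℕ} (ω : A [⋀^Fin q]→ₗ[R] R) (θ : A [⋀^Fin r]→ₗ[R] R) :
    wedgeForm q r ω θ =
      ((LinearMap.mul' R R).compAlternatingMap (ω.domCoprod θ)).domDomCongr finSumFinEquiv := by
  simp [wedgeForm]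

/-- The wedge product on the exterior algebra. -/
def extWedge : ExtForms R A →ₗ[R] ExtForms R A →ₗ[R] ExtForms R A :=
  DirectSum.toModule R ℕ _ fun q => LinearMap.flip (DirectSum.toModule R ℕ _ fun r =>
    LinearMap.flip ((wedgeForm q r).compr₂
      (DirectSum.lof R ℕ (fun k => A [⋀^Fin k]→ₗ[R] R) (q + r))))

theorem extWedge_of {q r : ℕ} (ω : A [⋀^Fin q]→ₗ[R] R) (θ : A [⋀^Fin r]→ₗ[R] R) :
    extWedge (DirectSum.lof R ℕ (fun k => A [⋀^Fin k]→ₗ[R] R) q ω)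
      (DirectSum.lof R ℕ (fun k => A [⋀^Fin k]→ₗ[R] R) r θ) =
    DirectSum.lof R ℕ (fun k => A [⋀^Fin k]→ₗ[R] R) (q + r) (wedgeForm q r ω θ) := by
  simp [extWedge]

/-- The exterior derivative on the exterior algebra. -/
def GenLieAlgebra.extDiff (L : GenLieAlgebra R A) : ExtForms R A →+ ExtForms R A :=
  DirectSum.toAddMonoid fun q =>
    (DirectSum.of (fun k => A [⋀^Fin k]→ₗ[R] R) (q + 1)).comp
      (AddMonoidHom.mk' L.extDer fun ω θ => AlternatingMap.ext fun z => L.koszul_add ω θ z)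

/-- Two-sided ideals of the exterior algebra. -/
structure IsExtIdeal (I : Submodule R (ExtForms R A)) : Prop where
  wedge_mem_left : ∀ θ, ∀ ω ∈ I, extWedge θ ω ∈ I
  wedge_mem_right : ∀ θ, ∀ ω ∈ I, extWedge ω θ ∈ I

/-- The ideal of the exterior algebra generated by a set. -/
def extIdealSpan (S : Set (ExtForms R A)) : Submodule R (ExtForms R A) :=
  sInf {I | IsExtIdeal I ∧ S ⊆ I}

/-- Ideals of the exterior algebra which are closed under the exterior derivative. -/
structure GenLieAlgebra.IsDifferentialIdeal (L : GenLieAlgebra R A)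
    (I : Submodule R (ExtForms R A)) : Prop where
  isExtIdeal : IsExtIdeal I
  extDiff_mem : ∀ ω ∈ I, L.extDiff ω ∈ I

/-- A linear form on `A`, as an element of degree one of the exterior algebra. -/
def oneForm (θ : Module.Dual R A) : ExtForms R A :=
  DirectSum.of (fun k => A [⋀^Fin k]→ₗ[R] R) 1 (AlternatingMap.ofSubsingleton R A R 0 θ)

end Forms

open scoped Manifold ContDiff Bundle Topology

section Sections

instance pullbackAddCommGroup {B B' : Type*} (f : B' → B) (V : B → Type*)
    [∀ x, AddCommGroup (V x)] (x : B') : AddCommGroup ((f *ᵖ V) x) :=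
  inferInstanceAs (AddCommGroup (V (f x)))

theorem contMDiffAt_pullback_iff {n : ℕ} {B : Type*} [TopologicalSpace B]
    [ChartedSpace (EuclideanSpace ℝ (Fin n)) B] {K : Type*} [NormedAddCommGroup K]
    [NormedSpace ℝ K] {V : B → Type*} [TopologicalSpace (Bundle.TotalSpace K V)]
    [∀ x, TopologicalSpace (V x)] [FiberBundle K V] [∀ x, Zero (V x)]
    {m : ℕ} {B' : Type*} [TopologicalSpace B']
    [ChartedSpace (EuclideanSpace ℝ (Fin m)) B'] (f : C^∞⟮𝓡 m, B'; 𝓡 n, B⟯)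
    (s : ∀ x : B', V (f x)) (x₀ : B') :
    ContMDiffAt (𝓡 m) ((𝓡 m).prod 𝓘(ℝ, K)) ∞
      (fun x => (⟨x, s x⟩ : Bundle.TotalSpace K (f *ᵖ V))) x₀ ↔
    ContMDiffAt (𝓡 m) ((𝓡 n).prod 𝓘(ℝ, K)) ∞
      (fun x => (⟨f x, s x⟩ : Bundle.TotalSpace K V)) x₀ := by
  rw [Bundle.contMDiffAt_totalSpace, Bundle.contMDiffAt_totalSpace]
  exact and_congr ⟨fun _ => f.contMDiff x₀, fun _ => contMDiffAt_id⟩ Iff.rfl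

variable {n : ℕ} {B : Type*} [TopologicalSpace B] [ChartedSpace (EuclideanSpace ℝ (Fin n)) B]
  {K : Type*} [NormedAddCommGroup K] [NormedSpace ℝ K]
  {V : B → Type*} [TopologicalSpace (Bundle.TotalSpace K V)] [∀ x, AddCommGroup (V x)]
  [∀ x, Module ℝ (V x)] [∀ x, TopologicalSpace (V x)] [FiberBundle K V] [VectorBundle ℝ K V]

noncomputable instance sectionSMul : SMul C^∞⟮𝓡 n, B; 𝓘(ℝ, ℝ), ℝ⟯ Cₛ^∞⟮𝓡 n; K, V⟯ where
  smul f s := ⟨fun x => f x • s x, f.contMDiff.smul_section s.contMDiff⟩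

@[simp] theorem section_smul_apply (f : C^∞⟮𝓡 n, B; 𝓘(ℝ, ℝ), ℝ⟯) (s : Cₛ^∞⟮𝓡 n; K, V⟯) (x : B) :
    (f • s) x = f x • s x := rfl

noncomputable instance sectionModule :
    Module C^∞⟮𝓡 n, B; 𝓘(ℝ, ℝ), ℝ⟯ Cₛ^∞⟮𝓡 n; K, V⟯ where
  one_smul s := by ext x; simp
  mul_smul f g s := by ext x; simp [mul_smul]
  smul_zero f := by ext x; simp
  smul_add f s t := by ext x; simp
  add_smul f g s := by ext x; simp [add_smul]
  zero_smul s := by ext x; simp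

variable (n B) in
/-- The inclusion of an open set, whose pull-back `inclMap n B U *ᵖ V` is the restriction of `V` to
`U`. -/
def inclMap (U : TopologicalSpace.Opens B) : C^∞⟮𝓡 n, U; 𝓡 n, B⟯ :=
  ⟨Subtype.val, contMDiff_subtype_val⟩


theorem exists_bump [T2Space B] [IsManifold (𝓡 n) ∞ B] (x : B) {W : Set B} (hW : W ∈ 𝓝 x) :
    ∃ χ : C^∞⟮𝓡 n, B; 𝓘(ℝ, ℝ), ℝ⟯, (∀ᶠ y in 𝓝 x, χ y = 1) ∧ tsupport χ ⊆ W := by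
  obtain ⟨f, -, hf⟩ := (SmoothBumpFunction.nhds_basis_tsupport (I := 𝓡 n) x).mem_iff.1 hW
  exact ⟨⟨f, f.contMDiff⟩, f.eventuallyEq_one, hf⟩

variable [T2Space B] [IsManifold (𝓡 n) ∞ B]

theorem exists_section_of_contMDiffOn [ContMDiffVectorBundle ∞ K V (𝓡 n)] {U : Set B}
    (hU : IsOpen U) (S : ∀ x, V x)
    (hS : ContMDiffOn (𝓡 n) ((𝓡 n).prod 𝓘(ℝ, K)) ∞
      (fun x => (⟨x, S x⟩ : Bundle.TotalSpace K V)) U) {x : B} (hx : x ∈ U) :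
    ∃ T : Cₛ^∞⟮𝓡 n; K, V⟯, ∀ᶠ y in 𝓝 x, T y = S y := by
  obtain ⟨χ, h1, h2⟩ := exists_bump (n := n) x (hU.mem_nhds hx)
  refine ⟨⟨fun y => χ y • S y, ContMDiffOn.smul_section_of_tsupport χ.contMDiff.contMDiffOn hU h2 hS⟩, ?_⟩
  filter_upwards [h1] with y hy
  simp [hy]

theorem exists_section_eq [ContMDiffVectorBundle ∞ K V (𝓡 n)] (x : B) (v : V x) :
    ∃ T : Cₛ^∞⟮𝓡 n; K, V⟯, T x = v := by
  have hmem := FiberBundle.mem_baseSet_trivializationAt' (F := K) (E := V) x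
  obtain ⟨T, hT⟩ := exists_section_of_contMDiffOn (n := n) (K := K) (V := V)
    (trivializationAt K V x).open_baseSet (FiberBundle.extend K v) (by
      intro y hy
      rw [(trivializationAt K V x).contMDiffWithinAt_section _ hy]
      have : ContMDiffOn (𝓡 n) 𝓘(ℝ, K) ∞
          (fun _ : B => (trivializationAt K V x ⟨x, v⟩).2) (trivializationAt K V x).baseSet :=
        contMDiffOn_const
      exact (this.congr fun z hz => by simp [FiberBundle.extend, hz]) y hy) hmem
  exact ⟨T, by simpa using hT.self_of_nhds⟩

theorem exists_extend_section [ContMDiffVectorBundle ∞ K V (𝓡 n)] (U : TopologicalSpace.Opens B)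
    (s : Cₛ^∞⟮𝓡 n; K, inclMap n B U *ᵖ V⟯) (x : U) :
    ∃ T : Cₛ^∞⟮𝓡 n; K, V⟯, ∀ᶠ y in 𝓝 x, T y.1 = s y := by
  classical
  let S : ∀ b, V b := fun b => if hb : b ∈ U then s ⟨b, hb⟩ else 0
  have hS : ∀ y : U, S y.1 = s y := fun y => dif_pos y.2
  obtain ⟨T, hT⟩ := exists_section_of_contMDiffOn (n := n) (K := K) (V := V) U.isOpen S (by
    intro y hy
    refine ContMDiffAt.contMDiffWithinAt ?_
    refine (contMDiffAt_subtype_iff (U := U) (x := ⟨y, hy⟩)).1 ?_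
    have := (contMDiffAt_pullback_iff (inclMap n B U) (fun z : U => s z) ⟨y, hy⟩).1
      (s.contMDiff ⟨y, hy⟩)
    refine this.congr_of_eventuallyEq (Filter.Eventually.of_forall fun z => ?_)
    exact congrArg (Bundle.TotalSpace.mk' K z.1) (hS z)) x.2
  refine ⟨T, ?_⟩
  filter_upwards [continuous_subtype_val.continuousAt.eventually hT] with y hy
  rw [hy, hS]

theorem exists_extend_fun (U : TopologicalSpace.Opens B)
    (f : C^∞⟮𝓡 n, U; 𝓘(ℝ, ℝ), ℝ⟯) (x : U) :
    ∃ g : C^∞⟮𝓡 n, B; 𝓘(ℝ, ℝ), ℝ⟯, ∀ᶠ y in 𝓝 x, g y.1 = f y := by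
  classical
  let S : B → ℝ := fun b => if hb : b ∈ U then f ⟨b, hb⟩ else 0
  have hS : ∀ y : U, S y.1 = f y := fun y => dif_pos y.2
  obtain ⟨χ, h1, h2⟩ := exists_bump (n := n) x.1 (U.isOpen.mem_nhds x.2)
  have hSm : ∀ y ∈ U, ContMDiffAt (𝓡 n) 𝓘(ℝ, ℝ) ∞ S y := by
    intro y hy
    refine (contMDiffAt_subtype_iff (U := U) (x := ⟨y, hy⟩)).1 ?_
    refine (f.contMDiff ⟨y, hy⟩).congr_of_eventuallyEq (Filter.Eventually.of_forall fun z => ?_)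
    exact hS z
  refine ⟨⟨fun y => χ y * S y, ?_⟩, ?_⟩
  · refine contMDiff_of_tsupport fun y hy => ?_
    exact (χ.contMDiff y).mul (hSm y (h2 (tsupport_mul_subset_left hy)))
  · filter_upwards [continuous_subtype_val.continuousAt.eventually h1] with y hy
    simp [hy, hS]

end Sections

theorem eventually_opens_iff {B : Type*} [TopologicalSpace B] (U : TopologicalSpace.Opens B) (x : U) (P : B → Prop) :
    (∀ᶠ y : U in 𝓝 x, P y.1) ↔ ∀ᶠ y in 𝓝 x.1, P y := by
  rw [← U.isOpen.isOpenEmbedding_subtypeVal.map_nhds_eq x]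
  exact Filter.eventually_map.symm

section Restriction

variable {n : ℕ} {B : Type*} [TopologicalSpace B] [ChartedSpace (EuclideanSpace ℝ (Fin n)) B]
  {K : Type*} [NormedAddCommGroup K] [NormedSpace ℝ K]
  {V : B → Type*} [TopologicalSpace (Bundle.TotalSpace K V)] [∀ x, AddCommGroup (V x)]
  [∀ x, Module ℝ (V x)] [∀ x, TopologicalSpace (V x)] [FiberBundle K V] [VectorBundle ℝ K V]
  [T2Space B] [IsManifold (𝓡 n) ∞ B]

namespace GenLieAlgebra

theorem bracket_zero {R A : Type*} [CommRing R] [AddCommGroup A] [Module R A]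
    (L : GenLieAlgebra R A) (u : A) : L.bracket u 0 = 0 := by
  have h := L.bracket_add u 0 0
  rw [add_zero] at h
  exact left_eq_add.1 h

theorem bracket_eq_zero (L : GenLieAlgebra C^∞⟮𝓡 n, B; 𝓘(ℝ, ℝ), ℝ⟯ Cₛ^∞⟮𝓡 n; K, V⟯)
    (S T : Cₛ^∞⟮𝓡 n; K, V⟯) {x : B} (hT : ∀ᶠ y in 𝓝 x, T y = 0) : L.bracket S T x = 0 := by
  obtain ⟨χ, h1, h2⟩ := exists_bump (n := n) x hT
  have h0 : χ • T = 0 := by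
    ext y
    by_cases hy : y ∈ tsupport χ
    · have : T y = 0 := h2 hy
      simp [this]
    · simp [image_eq_zero_of_notMem_tsupport hy]
  have h := L.leibniz S χ T
  rw [h0, L.bracket_zero] at h
  have hx := congrArg (fun s : Cₛ^∞⟮𝓡 n; K, V⟯ => s x) h
  simpa [h1.self_of_nhds, hT.self_of_nhds, eq_comm] using hx

theorem bracket_congr (L : GenLieAlgebra C^∞⟮𝓡 n, B; 𝓘(ℝ, ℝ), ℝ⟯ Cₛ^∞⟮𝓡 n; K, V⟯)
    {S S' T T' : Cₛ^∞⟮𝓡 n; K, V⟯} {x : B} (hS : ∀ᶠ y in 𝓝 x, S y = S' y)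
    (hT : ∀ᶠ y in 𝓝 x, T y = T' y) : L.bracket S T x = L.bracket S' T' x := by
  have aux : ∀ {P Q Q' : Cₛ^∞⟮𝓡 n; K, V⟯}, (∀ᶠ y in 𝓝 x, Q y = Q' y) →
      L.bracket P Q x = L.bracket P Q' x := by
    intro P Q Q' h
    have h0 : L.bracket P (Q - Q') x = 0 :=
      L.bracket_eq_zero P _ (h.mono fun y hy => by simp [hy])
    have h1 : L.bracket P Q = L.bracket P (Q - Q') + L.bracket P Q' := by
      rw [← L.bracket_add, sub_add_cancel]
    simp [h1, h0]
  rw [aux hT, L.bracket_swap S, L.bracket_swap S']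
  simp [aux hS]

theorem anchor_congr (L : GenLieAlgebra C^∞⟮𝓡 n, B; 𝓘(ℝ, ℝ), ℝ⟯ Cₛ^∞⟮𝓡 n; K, V⟯)
    {S S' : Cₛ^∞⟮𝓡 n; K, V⟯} {f f' : C^∞⟮𝓡 n, B; 𝓘(ℝ, ℝ), ℝ⟯} {x : B}
    (hS : ∀ᶠ y in 𝓝 x, S y = S' y) (hf : ∀ᶠ y in 𝓝 x, f y = f' y) :
    L.anchor S f x = L.anchor S' f' x := by
  have h1 : L.anchor (S - S') f x = 0 := by
    obtain ⟨χ, h1, h2⟩ := exists_bump (n := n) x hS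
    have h0 : χ • (S - S') = 0 := by
      ext y
      by_cases hy : y ∈ tsupport χ
      · have : S y = S' y := h2 hy
        simp [this]
      · simp [image_eq_zero_of_notMem_tsupport hy]
    have h := congrArg (fun X => X f x) (congrArg L.anchor h0)
    simpa [-map_sub, h1.self_of_nhds] using h
  have h2 : L.anchor S' (f - f') x = 0 := by
    obtain ⟨χ, h1, h2⟩ := exists_bump (n := n) x hf
    have h0 : χ * (f - f') = 0 := by
      ext y
      by_cases hy : y ∈ tsupport χ
      · have : f y = f' y := h2 hy
        simp [this]
      · simp [image_eq_zero_of_notMem_tsupport hy]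
    have h := congrArg (fun g : C^∞⟮𝓡 n, B; 𝓘(ℝ, ℝ), ℝ⟯ => g x) (congrArg (L.anchor S') h0)
    simpa [-map_sub, h1.self_of_nhds, hf.self_of_nhds] using h
  have e1 : L.anchor S f = L.anchor (S - S') f + L.anchor S' (f - f') + L.anchor S' f' := by
    simp
  simp only [e1, ContMDiffMap.coe_add, Pi.add_apply, h1, h2, zero_add]

end GenLieAlgebra

end Restriction

section Restriction

variable {n : ℕ} {B : Type*} [TopologicalSpace B] [ChartedSpace (EuclideanSpace ℝ (Fin n)) B]
  {K : Type*} [NormedAddCommGroup K] [NormedSpace ℝ K]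
  {V : B → Type*} [TopologicalSpace (Bundle.TotalSpace K V)] [∀ x, AddCommGroup (V x)]
  [∀ x, Module ℝ (V x)] [∀ x, TopologicalSpace (V x)] [FiberBundle K V] [VectorBundle ℝ K V]
  [T2Space B] [IsManifold (𝓡 n) ∞ B] [ContMDiffVectorBundle ∞ K V (𝓡 n)]

/-- A global section with the same germ at `x` as the given section over `U`. -/
noncomputable def extSection (U : TopologicalSpace.Opens B)
    (s : Cₛ^∞⟮𝓡 n; K, inclMap n B U *ᵖ V⟯) (x : U) : Cₛ^∞⟮𝓡 n; K, V⟯ :=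
  Classical.choose (exists_extend_section U s x)

theorem extSection_eventually (U : TopologicalSpace.Opens B)
    (s : Cₛ^∞⟮𝓡 n; K, inclMap n B U *ᵖ V⟯) (x : U) :
    ∀ᶠ y in 𝓝 x, extSection U s x y.1 = s y :=
  Classical.choose_spec (exists_extend_section U s x)

/-- A global function with the same germ at `x` as the given function on `U`. -/
noncomputable def extFun (U : TopologicalSpace.Opens B)
    (f : C^∞⟮𝓡 n, U; 𝓘(ℝ, ℝ), ℝ⟯) (x : U) : C^∞⟮𝓡 n, B; 𝓘(ℝ, ℝ), ℝ⟯ :=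
  Classical.choose (exists_extend_fun U f x)

theorem extFun_eventually (U : TopologicalSpace.Opens B)
    (f : C^∞⟮𝓡 n, U; 𝓘(ℝ, ℝ), ℝ⟯) (x : U) :
    ∀ᶠ y in 𝓝 x, extFun U f x y.1 = f y :=
  Classical.choose_spec (exists_extend_fun U f x)

theorem contMDiff_pullback_of_germs (U : TopologicalSpace.Opens B) (s : ∀ x : U, V x.1)
    (h : ∀ x : U, ∃ T : Cₛ^∞⟮𝓡 n; K, V⟯, ∀ᶠ y in 𝓝 x, T y.1 = s y) :
    ContMDiff (𝓡 n) ((𝓡 n).prod 𝓘(ℝ, K)) ∞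
      (fun x : U => (⟨x, s x⟩ : Bundle.TotalSpace K (inclMap n B U *ᵖ V))) := by
  intro x
  obtain ⟨T, hT⟩ := h x
  refine (contMDiffAt_pullback_iff (inclMap n B U) s x).2 ?_
  have h1 : ContMDiffAt (𝓡 n) ((𝓡 n).prod 𝓘(ℝ, K)) ∞
      (fun y : U => (⟨y.1, T y.1⟩ : Bundle.TotalSpace K V)) x :=
    (T.contMDiff x.1).comp x (contMDiff_subtype_val x)
  refine h1.congr_of_eventuallyEq ?_
  filter_upwards [hT] with y hy
  exact congrArg (Bundle.TotalSpace.mk' K y.1) hy.symm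

theorem contMDiff_of_germs (U : TopologicalSpace.Opens B) (f : U → ℝ)
    (h : ∀ x : U, ∃ g : C^∞⟮𝓡 n, B; 𝓘(ℝ, ℝ), ℝ⟯, ∀ᶠ y in 𝓝 x, g y.1 = f y) :
    ContMDiff (𝓡 n) 𝓘(ℝ, ℝ) ∞ f := by
  intro x
  obtain ⟨g, hg⟩ := h x
  have h1 : ContMDiffAt (𝓡 n) 𝓘(ℝ, ℝ) ∞ (fun y : U => g y.1) x :=
    (g.contMDiff x.1).comp x (contMDiff_subtype_val x)
  exact h1.congr_of_eventuallyEq (hg.mono fun y hy => hy.symm)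

namespace GenLieAlgebra

variable (L : GenLieAlgebra C^∞⟮𝓡 n, B; 𝓘(ℝ, ℝ), ℝ⟯ Cₛ^∞⟮𝓡 n; K, V⟯)
  (U : TopologicalSpace.Opens B)

theorem bracket_congr_opens {S S' T T' : Cₛ^∞⟮𝓡 n; K, V⟯} {x : U}
    (hS : ∀ᶠ y in 𝓝 x, S y.1 = S' y.1) (hT : ∀ᶠ y in 𝓝 x, T y.1 = T' y.1) :
    L.bracket S T x.1 = L.bracket S' T' x.1 :=
  L.bracket_congr ((eventually_opens_iff U x fun y => S y = S' y).1 hS)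
    ((eventually_opens_iff U x fun y => T y = T' y).1 hT)

theorem anchor_congr_opens {S S' : Cₛ^∞⟮𝓡 n; K, V⟯} {f f' : C^∞⟮𝓡 n, B; 𝓘(ℝ, ℝ), ℝ⟯} {x : U}
    (hS : ∀ᶠ y in 𝓝 x, S y.1 = S' y.1) (hf : ∀ᶠ y in 𝓝 x, f y.1 = f' y.1) :
    L.anchor S f x.1 = L.anchor S' f' x.1 :=
  L.anchor_congr ((eventually_opens_iff U x fun y => S y = S' y).1 hS)
    ((eventually_opens_iff U x fun y => f y = f' y).1 hf)

theorem bracket_ext_eventually (s t : Cₛ^∞⟮𝓡 n; K, inclMap n B U *ᵖ V⟯)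
    {S T : Cₛ^∞⟮𝓡 n; K, V⟯} {x : U} (hS : ∀ᶠ y in 𝓝 x, S y.1 = s y)
    (hT : ∀ᶠ y in 𝓝 x, T y.1 = t y) : ∀ᶠ y in 𝓝 x,
      L.bracket S T y.1 = L.bracket (extSection U s y) (extSection U t y) y.1 := by
  filter_upwards [eventually_eventually_nhds.2 hS, eventually_eventually_nhds.2 hT] with y h1 h2
  refine L.bracket_congr_opens U ?_ ?_
  · filter_upwards [h1, extSection_eventually U s y] with z h3 h4
    exact h3.trans h4.symm
  · filter_upwards [h2, extSection_eventually U t y] with z h3 h4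
    exact h3.trans h4.symm

theorem anchor_ext_eventually (s : Cₛ^∞⟮𝓡 n; K, inclMap n B U *ᵖ V⟯)
    (f : C^∞⟮𝓡 n, U; 𝓘(ℝ, ℝ), ℝ⟯) {S : Cₛ^∞⟮𝓡 n; K, V⟯} {g : C^∞⟮𝓡 n, B; 𝓘(ℝ, ℝ), ℝ⟯} {x : U}
    (hS : ∀ᶠ y in 𝓝 x, S y.1 = s y) (hg : ∀ᶠ y in 𝓝 x, g y.1 = f y) : ∀ᶠ y in 𝓝 x,
      L.anchor S g y.1 = L.anchor (extSection U s y) (extFun U f y) y.1 := by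
  filter_upwards [eventually_eventually_nhds.2 hS, eventually_eventually_nhds.2 hg] with y h1 h2
  refine L.anchor_congr_opens U ?_ ?_
  · filter_upwards [h1, extSection_eventually U s y] with z h3 h4
    exact h3.trans h4.symm
  · filter_upwards [h2, extFun_eventually U f y] with z h3 h4
    exact h3.trans h4.symm

/-- The bracket of two sections over `U`, computed at each point from germs. -/
noncomputable def restrictBracket (s t : Cₛ^∞⟮𝓡 n; K, inclMap n B U *ᵖ V⟯) :
    Cₛ^∞⟮𝓡 n; K, inclMap n B U *ᵖ V⟯ :=
  ⟨fun x => L.bracket (extSection U s x) (extSection U t x) x.1,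
    contMDiff_pullback_of_germs U _ fun x => ⟨L.bracket (extSection U s x) (extSection U t x),
      L.bracket_ext_eventually U s t (extSection_eventually U s x) (extSection_eventually U t x)⟩⟩

theorem restrictBracket_eventually (s t : Cₛ^∞⟮𝓡 n; K, inclMap n B U *ᵖ V⟯)
    {S T : Cₛ^∞⟮𝓡 n; K, V⟯} {x : U} (hS : ∀ᶠ y in 𝓝 x, S y.1 = s y)
    (hT : ∀ᶠ y in 𝓝 x, T y.1 = t y) :
    ∀ᶠ y in 𝓝 x, L.bracket S T y.1 = L.restrictBracket U s t y :=
  L.bracket_ext_eventually U s t hS hT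

/-- The derivative of a function on `U` along a section over `U`, computed from germs. -/
noncomputable def restrictAnchorFun (s : Cₛ^∞⟮𝓡 n; K, inclMap n B U *ᵖ V⟯)
    (f : C^∞⟮𝓡 n, U; 𝓘(ℝ, ℝ), ℝ⟯) : C^∞⟮𝓡 n, U; 𝓘(ℝ, ℝ), ℝ⟯ :=
  ⟨fun x => L.anchor (extSection U s x) (extFun U f x) x.1,
    contMDiff_of_germs U _ fun x => ⟨L.anchor (extSection U s x) (extFun U f x),
      L.anchor_ext_eventually U s f (extSection_eventually U s x) (extFun_eventually U f x)⟩⟩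

theorem restrictAnchorFun_eq (s : Cₛ^∞⟮𝓡 n; K, inclMap n B U *ᵖ V⟯)
    (f : C^∞⟮𝓡 n, U; 𝓘(ℝ, ℝ), ℝ⟯) {S : Cₛ^∞⟮𝓡 n; K, V⟯} {g : C^∞⟮𝓡 n, B; 𝓘(ℝ, ℝ), ℝ⟯} {x : U}
    (hS : ∀ᶠ y in 𝓝 x, S y.1 = s y) (hg : ∀ᶠ y in 𝓝 x, g y.1 = f y) :
    L.restrictAnchorFun U s f x = L.anchor S g x.1 :=
  (L.anchor_ext_eventually U s f hS hg).self_of_nhds.symm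

theorem restrictAnchorFun_eventually (s : Cₛ^∞⟮𝓡 n; K, inclMap n B U *ᵖ V⟯)
    (f : C^∞⟮𝓡 n, U; 𝓘(ℝ, ℝ), ℝ⟯) {S : Cₛ^∞⟮𝓡 n; K, V⟯} {g : C^∞⟮𝓡 n, B; 𝓘(ℝ, ℝ), ℝ⟯} {x : U}
    (hS : ∀ᶠ y in 𝓝 x, S y.1 = s y) (hg : ∀ᶠ y in 𝓝 x, g y.1 = f y) :
    ∀ᶠ y in 𝓝 x, L.anchor S g y.1 = L.restrictAnchorFun U s f y :=
  L.anchor_ext_eventually U s f hS hg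

/-- The derivation of `C^∞(U)` attached to a section over `U`. -/
noncomputable def restrictAnchor (s : Cₛ^∞⟮𝓡 n; K, inclMap n B U *ᵖ V⟯) :
    Derivation ℤ C^∞⟮𝓡 n, U; 𝓘(ℝ, ℝ), ℝ⟯ C^∞⟮𝓡 n, U; 𝓘(ℝ, ℝ), ℝ⟯ :=
  Derivation.mk' (AddMonoidHom.mk' (L.restrictAnchorFun U s) (by
    intro f g
    ext x
    have hs := extSection_eventually U s x
    have hf := extFun_eventually U f x
    have hg := extFun_eventually U g x
    have hfg : ∀ᶠ y in 𝓝 x, (extFun U f x + extFun U g x) y.1 = (f + g) y := by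
      filter_upwards [hf, hg] with y h1 h2
      simp [h1, h2]
    rw [L.restrictAnchorFun_eq U s _ hs hfg, ContMDiffMap.coe_add, Pi.add_apply,
      L.restrictAnchorFun_eq U s _ hs hf, L.restrictAnchorFun_eq U s _ hs hg]
    simp)).toIntLinearMap (by
    intro f g
    ext x
    have hs := extSection_eventually U s x
    have hf := extFun_eventually U f x
    have hg := extFun_eventually U g x
    have hfg : ∀ᶠ y in 𝓝 x, (extFun U f x * extFun U g x) y.1 = (f * g) y := by
      filter_upwards [hf, hg] with y h1 h2
      simp [h1, h2]
    have e : L.restrictAnchorFun U s (f * g) x =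
        f x * L.restrictAnchorFun U s g x + g x * L.restrictAnchorFun U s f x := by
      rw [L.restrictAnchorFun_eq U s _ hs hfg, L.restrictAnchorFun_eq U s _ hs hf,
        L.restrictAnchorFun_eq U s _ hs hg]
      simp [hf.self_of_nhds, hg.self_of_nhds]
    exact e)

theorem restrictAnchor_apply (s : Cₛ^∞⟮𝓡 n; K, inclMap n B U *ᵖ V⟯)
    (f : C^∞⟮𝓡 n, U; 𝓘(ℝ, ℝ), ℝ⟯) : L.restrictAnchor U s f = L.restrictAnchorFun U s f := rfl

theorem restrictBracket_eq (s t : Cₛ^∞⟮𝓡 n; K, inclMap n B U *ᵖ V⟯)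
    {S T : Cₛ^∞⟮𝓡 n; K, V⟯} {x : U} (hS : ∀ᶠ y in 𝓝 x, S y.1 = s y)
    (hT : ∀ᶠ y in 𝓝 x, T y.1 = t y) :
    L.restrictBracket U s t x = L.bracket S T x.1 :=
  (L.bracket_ext_eventually U s t hS hT).self_of_nhds.symm

theorem ext_add_eventually {s t : Cₛ^∞⟮𝓡 n; K, inclMap n B U *ᵖ V⟯}
    {S T : Cₛ^∞⟮𝓡 n; K, V⟯} {x : U} (hS : ∀ᶠ y in 𝓝 x, S y.1 = s y)
    (hT : ∀ᶠ y in 𝓝 x, T y.1 = t y) : ∀ᶠ y in 𝓝 x, (S + T) y.1 = (s + t) y := by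
  filter_upwards [hS, hT] with y h1 h2
  exact congrArg₂ (fun a b : V y.1 => a + b) h1 h2

theorem ext_smul_eventually {f : C^∞⟮𝓡 n, U; 𝓘(ℝ, ℝ), ℝ⟯}
    {s : Cₛ^∞⟮𝓡 n; K, inclMap n B U *ᵖ V⟯} {g : C^∞⟮𝓡 n, B; 𝓘(ℝ, ℝ), ℝ⟯}
    {S : Cₛ^∞⟮𝓡 n; K, V⟯} {x : U} (hg : ∀ᶠ y in 𝓝 x, g y.1 = f y)
    (hS : ∀ᶠ y in 𝓝 x, S y.1 = s y) : ∀ᶠ y in 𝓝 x, (g • S) y.1 = (f • s) y := by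
  filter_upwards [hg, hS] with y h1 h2
  exact congrArg₂ (fun (a : ℝ) (b : V y.1) => a • b) h1 h2

/-- The restriction to an open set `U`: the bracket and the anchor at a point of `U` are computed
by replacing sections over `U` and functions on `U` by global ones with the same germ there. -/
noncomputable def restrict : GenLieAlgebra C^∞⟮𝓡 n, U; 𝓘(ℝ, ℝ), ℝ⟯
    Cₛ^∞⟮𝓡 n; K, inclMap n B U *ᵖ V⟯ where
  anchor :=
    { toFun := L.restrictAnchor U
      map_add' := fun s t => by
        ext f x
        have hs := extSection_eventually U s x
        have ht := extSection_eventually U t x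
        have hf := extFun_eventually U f x
        have e : L.restrictAnchorFun U (s + t) f x =
            L.restrictAnchorFun U s f x + L.restrictAnchorFun U t f x := by
          rw [L.restrictAnchorFun_eq U _ _ (ext_add_eventually U hs ht) hf,
            L.restrictAnchorFun_eq U _ _ hs hf, L.restrictAnchorFun_eq U _ _ ht hf]
          simp
        exact e
      map_smul' := fun g s => by
        ext f x
        have hs := extSection_eventually U s x
        have hg := extFun_eventually U g x
        have hf := extFun_eventually U f x
        have e : L.restrictAnchorFun U (g • s) f x = g x * L.restrictAnchorFun U s f x := by
          rw [L.restrictAnchorFun_eq U _ _ (ext_smul_eventually U hg hs) hf,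
            L.restrictAnchorFun_eq U _ _ hs hf]
          simp [hg.self_of_nhds]
        exact e }
  bracket := L.restrictBracket U
  add_bracket u v w := by
    ext x
    have hu := extSection_eventually U u x
    have hv := extSection_eventually U v x
    have hw := extSection_eventually U w x
    have h1 := L.restrictBracket_eq U (u + v) w (ext_add_eventually U hu hv) hw
    rw [L.add_bracket] at h1
    exact h1.trans (congrArg₂ (fun a b : V x.1 => a + b) (L.restrictBracket_eq U u w hu hw).symm
      (L.restrictBracket_eq U v w hv hw).symm)
  bracket_add u v w := by
    ext x
    have hu := extSection_eventually U u x
    have hv := extSection_eventually U v x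
    have hw := extSection_eventually U w x
    have h1 := L.restrictBracket_eq U u (v + w) hu (ext_add_eventually U hv hw)
    rw [L.bracket_add] at h1
    exact h1.trans (congrArg₂ (fun a b : V x.1 => a + b) (L.restrictBracket_eq U u v hu hv).symm
      (L.restrictBracket_eq U u w hu hw).symm)
  bracket_self u := by
    ext x
    have hu := extSection_eventually U u x
    have h1 := L.restrictBracket_eq U u u hu hu
    rw [L.bracket_self] at h1
    exact h1
  jacobi u v w := by
    ext x
    have hu := extSection_eventually U u x
    have hv := extSection_eventually U v x
    have hw := extSection_eventually U w x
    have h1 := L.restrictBracket_eq U u _ hu (L.restrictBracket_eventually U v w hv hw)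
    have h2 := L.restrictBracket_eq U w _ hw (L.restrictBracket_eventually U u v hu hv)
    have h3 := L.restrictBracket_eq U v _ hv (L.restrictBracket_eventually U w u hw hu)
    have h := congrArg (fun s : Cₛ^∞⟮𝓡 n; K, V⟯ => s x.1)
      (L.jacobi (extSection U u x) (extSection U v x) (extSection U w x))
    refine Eq.trans ?_ h
    exact congrArg₂ (fun a b : V x.1 => a + b)
      (congrArg₂ (fun a b : V x.1 => a + b) h1 h2) h3
  leibniz u f v := by
    ext x
    have hu := extSection_eventually U u x
    have hv := extSection_eventually U v x
    have hf := extFun_eventually U f x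
    have h1 := L.restrictBracket_eq U u _ hu (ext_smul_eventually U hf hv)
    rw [L.leibniz] at h1
    refine h1.trans ?_
    refine congrArg₂ (fun a b : V x.1 => a + b)
      (congrArg₂ (fun (a : ℝ) (b : V x.1) => a • b) hf.self_of_nhds
        (L.restrictBracket_eq U u v hu hv).symm)
      (congrArg₂ (fun (a : ℝ) (b : V x.1) => a • b)
        (L.restrictAnchorFun_eq U u f hu hf).symm hv.self_of_nhds)

end GenLieAlgebra

end Restriction

section Algebroid

/-- Two diffeomorphisms `h : M → N`, `η : N → M` and a vector bundle morphism `(ρ, η)` from the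
vector bundle `F` over `N` to the tangent bundle of `M`. -/
structure AnchorDiagram (m n : ℕ) (M N : Type*) [TopologicalSpace M]
    [ChartedSpace (EuclideanSpace ℝ (Fin m)) M] [TopologicalSpace N]
    [ChartedSpace (EuclideanSpace ℝ (Fin n)) N] [IsManifold (𝓡 m) ∞ M]
    (K : Type*) [NormedAddCommGroup K] [NormedSpace ℝ K]
    (F : N → Type*) [TopologicalSpace (Bundle.TotalSpace K F)] [∀ y, AddCommGroup (F y)]
    [∀ y, Module ℝ (F y)] [∀ y, TopologicalSpace (F y)] [FiberBundle K F] where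
  h : M ≃ₘ^∞⟮𝓡 m, 𝓡 n⟯ N
  η : N ≃ₘ^∞⟮𝓡 n, 𝓡 m⟯ M
  ρ : ∀ y : N, F y →ₗ[ℝ] TangentSpace (𝓡 m) (η y)
  contMDiff_ρ : ContMDiff ((𝓡 n).prod 𝓘(ℝ, K)) (𝓡 m).tangent ∞
    (fun v : Bundle.TotalSpace K F => (⟨η v.1, ρ v.1 v.2⟩ : TangentBundle (𝓡 m) M))

variable {m n : ℕ} {M N : Type*} [TopologicalSpace M]
    [ChartedSpace (EuclideanSpace ℝ (Fin m)) M] [TopologicalSpace N]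
    [ChartedSpace (EuclideanSpace ℝ (Fin n)) N] [IsManifold (𝓡 m) ∞ M] [IsManifold (𝓡 n) ∞ N]
    {K : Type*} [NormedAddCommGroup K] [NormedSpace ℝ K]
    {F : N → Type*} [TopologicalSpace (Bundle.TotalSpace K F)] [∀ y, AddCommGroup (F y)]
    [∀ y, Module ℝ (F y)] [∀ y, TopologicalSpace (F y)] [FiberBundle K F] [VectorBundle ℝ K F]

/-- The derivative of a smooth function along a tangent vector. -/
noncomputable def dirDeriv (f : C^∞⟮𝓡 n, N; 𝓘(ℝ, ℝ), ℝ⟯) {z : N} (w : TangentSpace (𝓡 n) z) : ℝ :=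
  mfderiv (𝓡 n) 𝓘(ℝ, ℝ) f z w

theorem dirDeriv_add (f g : C^∞⟮𝓡 n, N; 𝓘(ℝ, ℝ), ℝ⟯) {z : N} (w : TangentSpace (𝓡 n) z) :
    dirDeriv (f + g) w = dirDeriv f w + dirDeriv g w := by
  have hf := (f.contMDiff.mdifferentiable (by simp) z).hasMFDerivAt
  have hg := (g.contMDiff.mdifferentiable (by simp) z).hasMFDerivAt
  exact congrArg (fun D => D w) (hf.add hg).mfderiv

theorem dirDeriv_mul (f g : C^∞⟮𝓡 n, N; 𝓘(ℝ, ℝ), ℝ⟯) {z : N} (w : TangentSpace (𝓡 n) z) :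
    dirDeriv (f * g) w = f z * dirDeriv g w + g z * dirDeriv f w := by
  have hf := (f.contMDiff.mdifferentiable (by simp) z).hasMFDerivAt
  have hg := (g.contMDiff.mdifferentiable (by simp) z).hasMFDerivAt
  exact congrArg (fun D => D w) (hf.mul hg).mfderiv

theorem dirDeriv_vadd (f : C^∞⟮𝓡 n, N; 𝓘(ℝ, ℝ), ℝ⟯) {z : N} (w w' : TangentSpace (𝓡 n) z) :
    dirDeriv f (w + w') = dirDeriv f w + dirDeriv f w' :=
  map_add (mfderiv (𝓡 n) 𝓘(ℝ, ℝ) f z) w w'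

theorem dirDeriv_smul (f : C^∞⟮𝓡 n, N; 𝓘(ℝ, ℝ), ℝ⟯) {z : N} (c : ℝ) (w : TangentSpace (𝓡 n) z) :
    dirDeriv f (c • w) = c * dirDeriv f w :=
  map_smul (mfderiv (𝓡 n) 𝓘(ℝ, ℝ) f z) c w

namespace AnchorDiagram

variable (D : AnchorDiagram m n M N K F)

/-- The vector `Th (ρ v)`, tangent to `N` at the point `h (η y)`, of a vector `v` of the fibre of
`F` over `y`. -/
noncomputable def vec (y : N) (v : F y) : TangentSpace (𝓡 n) (D.h (D.η y)) :=
  mfderiv (𝓡 m) (𝓡 n) D.h (D.η y) (D.ρ y v)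

theorem vec_add (y : N) (v w : F y) : D.vec y (v + w) = D.vec y v + D.vec y w := by
  simp [vec]

theorem vec_smul (y : N) (c : ℝ) (v : F y) : D.vec y (c • v) = c • D.vec y v := by
  simp [vec]

/-- The inverse of the diffeomorphism `h ∘ η` of `N`. -/
noncomputable def back (z : N) : N := D.η.symm (D.h.symm z)

theorem h_η_back (z : N) : D.h (D.η (D.back z)) = z := by
  simp [back]

theorem back_h_η (y : N) : D.back (D.h (D.η y)) = y := by
  simp [back]

/-- The vector field `Γ(Th ∘ ρ, h ∘ η)(u) = (Th ∘ ρ) ∘ u ∘ (h ∘ η)⁻¹` on `N` of a section `u` of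
`F`, applied to the function `f`. -/
noncomputable def act (u : Cₛ^∞⟮𝓡 n; K, F⟯) (f : C^∞⟮𝓡 n, N; 𝓘(ℝ, ℝ), ℝ⟯) :
    C^∞⟮𝓡 n, N; 𝓘(ℝ, ℝ), ℝ⟯ :=
  ⟨fun z => dirDeriv f (D.vec (D.back z) (u (D.back z))), by
    have h1 : ContMDiff (𝓡 n) (𝓡 m).tangent ∞ (fun z => (⟨D.η (D.back z),
        D.ρ (D.back z) (u (D.back z))⟩ : TangentBundle (𝓡 m) M)) :=
      D.contMDiff_ρ.comp (u.contMDiff.comp (D.η.symm.contMDiff.comp D.h.symm.contMDiff))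
    have h2 : ContMDiff (𝓡 m).tangent (𝓡 n).tangent ∞ (tangentMap (𝓡 m) (𝓡 n) D.h) :=
      D.h.contMDiff.contMDiff_tangentMap le_rfl
    have h3 : ContMDiff (𝓡 n).tangent 𝓘(ℝ, ℝ).tangent ∞ (tangentMap (𝓡 n) 𝓘(ℝ, ℝ) f) :=
      f.contMDiff.contMDiff_tangentMap le_rfl
    exact (contMDiff_snd_tangentBundle_modelSpace ℝ 𝓘(ℝ, ℝ)).comp (h3.comp (h2.comp h1))⟩

theorem act_apply (u : Cₛ^∞⟮𝓡 n; K, F⟯) (f : C^∞⟮𝓡 n, N; 𝓘(ℝ, ℝ), ℝ⟯) (z : N) :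
    D.act u f z = dirDeriv f (D.vec (D.back z) (u (D.back z))) := rfl

theorem act_add_left (u v : Cₛ^∞⟮𝓡 n; K, F⟯) (f : C^∞⟮𝓡 n, N; 𝓘(ℝ, ℝ), ℝ⟯) :
    D.act (u + v) f = D.act u f + D.act v f := by
  ext z
  simp [act_apply, vec_add, dirDeriv_vadd]

theorem act_smul_apply (g : C^∞⟮𝓡 n, N; 𝓘(ℝ, ℝ), ℝ⟯) (u : Cₛ^∞⟮𝓡 n; K, F⟯)
    (f : C^∞⟮𝓡 n, N; 𝓘(ℝ, ℝ), ℝ⟯) (z : N) :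
    D.act (g • u) f z = g (D.back z) * D.act u f z := by
  simp [act_apply, vec_smul, dirDeriv_smul]

theorem act_add (u : Cₛ^∞⟮𝓡 n; K, F⟯) (f g : C^∞⟮𝓡 n, N; 𝓘(ℝ, ℝ), ℝ⟯) :
    D.act u (f + g) = D.act u f + D.act u g := by
  ext z
  simp [act_apply, dirDeriv_add]

theorem act_mul (u : Cₛ^∞⟮𝓡 n; K, F⟯) (f g : C^∞⟮𝓡 n, N; 𝓘(ℝ, ℝ), ℝ⟯) :
    D.act u (f * g) = f * D.act u g + g * D.act u f := by
  ext z
  simp [act_apply, dirDeriv_mul, D.h_η_back]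

end AnchorDiagram

/-- A generalized Lie algebroid: the vector bundle `F`, the diffeomorphisms `h` and `η`, the vector
bundle morphism `(ρ, η)`, and a Lie bracket on the sections of `F` satisfying the Leibniz rule with
respect to `Γ(Th ∘ ρ, h ∘ η)`. -/
structure GenLieAlgebroid (m n : ℕ) (M N : Type*) [TopologicalSpace M]
    [ChartedSpace (EuclideanSpace ℝ (Fin m)) M] [TopologicalSpace N]
    [ChartedSpace (EuclideanSpace ℝ (Fin n)) N] [IsManifold (𝓡 m) ∞ M] [IsManifold (𝓡 n) ∞ N]
    (K : Type*) [NormedAddCommGroup K] [NormedSpace ℝ K]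
    (F : N → Type*) [TopologicalSpace (Bundle.TotalSpace K F)] [∀ y, AddCommGroup (F y)]
    [∀ y, Module ℝ (F y)] [∀ y, TopologicalSpace (F y)] [FiberBundle K F] [VectorBundle ℝ K F]
    extends AnchorDiagram m n M N K F where
  bracket : Cₛ^∞⟮𝓡 n; K, F⟯ → Cₛ^∞⟮𝓡 n; K, F⟯ → Cₛ^∞⟮𝓡 n; K, F⟯
  add_bracket : ∀ u v w, bracket (u + v) w = bracket u w + bracket v w
  bracket_add : ∀ u v w, bracket u (v + w) = bracket u v + bracket u w
  bracket_self : ∀ u, bracket u u = 0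
  jacobi : ∀ u v w, bracket u (bracket v w) + bracket w (bracket u v) + bracket v (bracket w u) = 0
  leibniz : ∀ (u : Cₛ^∞⟮𝓡 n; K, F⟯) (f : C^∞⟮𝓡 n, N; 𝓘(ℝ, ℝ), ℝ⟯) (v : Cₛ^∞⟮𝓡 n; K, F⟯),
    bracket u (f • v) = f • bracket u v + toAnchorDiagram.act u f • v

namespace GenLieAlgebroid

variable (𝔉 : GenLieAlgebroid m n M N K F)

theorem bracket_swap (u v : Cₛ^∞⟮𝓡 n; K, F⟯) : 𝔉.bracket u v = -𝔉.bracket v u := by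
  have h := 𝔉.bracket_self (u + v)
  rw [𝔉.add_bracket, 𝔉.bracket_add, 𝔉.bracket_add, 𝔉.bracket_self, 𝔉.bracket_self, zero_add,
    add_zero] at h
  exact eq_neg_of_add_eq_zero_left h

theorem smul_bracket (f : C^∞⟮𝓡 n, N; 𝓘(ℝ, ℝ), ℝ⟯) (u v : Cₛ^∞⟮𝓡 n; K, F⟯) :
    𝔉.bracket (f • u) v = f • 𝔉.bracket u v - 𝔉.act v f • u := by
  rw [𝔉.bracket_swap, 𝔉.leibniz, 𝔉.bracket_swap u v, smul_neg]
  abel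

/-- The anchor is automatically linear over the smooth functions: the two ways of expanding
`[g • u, f • v]` agree. -/
theorem act_smul [T2Space N] [ContMDiffVectorBundle ∞ K F (𝓡 n)]
    (g : C^∞⟮𝓡 n, N; 𝓘(ℝ, ℝ), ℝ⟯) (u : Cₛ^∞⟮𝓡 n; K, F⟯)
    (f : C^∞⟮𝓡 n, N; 𝓘(ℝ, ℝ), ℝ⟯) : 𝔉.act (g • u) f = g * 𝔉.act u f := by
  ext z
  rw [𝔉.act_smul_apply, ContMDiffMap.coe_mul, Pi.mul_apply]
  by_cases hz : 𝔉.back z = z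
  · rw [hz]
  suffices h0 : 𝔉.act u f z = 0 by rw [h0, mul_zero, mul_zero]
  by_cases hv : ∃ v : F z, v ≠ 0
  · obtain ⟨v, hv⟩ := hv
    obtain ⟨T, hT⟩ := exists_section_eq (n := n) (K := K) z v
    obtain ⟨χ, h1, h2⟩ := exists_bump (n := n) (𝔉.back z) (isOpen_ne.mem_nhds hz)
    have hχ1 : χ (𝔉.back z) = 1 := h1.self_of_nhds
    have hχ0 : χ z = 0 := image_eq_zero_of_notMem_tsupport fun hmem => h2 hmem rfl
    have hA : 𝔉.bracket (χ • u) (f • T) =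
        f • (χ • 𝔉.bracket u T - 𝔉.act T χ • u) + 𝔉.act (χ • u) f • T := by
      rw [𝔉.leibniz, 𝔉.smul_bracket]
    have hB : 𝔉.bracket (χ • u) (f • T) =
        χ • (f • 𝔉.bracket u T + 𝔉.act u f • T) - 𝔉.act (f • T) χ • u := by
      rw [𝔉.smul_bracket, 𝔉.leibniz]
    have e := congrArg (fun s : Cₛ^∞⟮𝓡 n; K, F⟯ => s z) (hA.symm.trans hB)
    have hd : 𝔉.act T χ z = 0 := by
      have hloc : χ =ᶠ[𝓝 z] fun _ => (0 : ℝ) :=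
        notMem_tsupport_iff_eventuallyEq.1 fun hmem => h2 hmem rfl
      rw [𝔉.act_apply]
      generalize 𝔉.vec (𝔉.back z) (T (𝔉.back z)) = w
      revert w
      rw [𝔉.h_η_back]
      intro w
      rw [dirDeriv, hloc.mfderiv_eq, mfderiv_const]
      rfl
    have hd' : 𝔉.act (f • T) χ z = 0 := by rw [𝔉.act_smul_apply, hd, mul_zero]
    have e' : 𝔉.act u f z • v = 0 := by
      simpa [hd, hd', hχ0, 𝔉.act_smul_apply, hχ1, hT] using e
    exact (smul_eq_zero.1 e').resolve_right hv
  · push Not at hv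
    have hK : ∀ k : K, k = 0 := by
      intro k
      let c := (trivializationAt K F z).continuousLinearEquivAt ℝ z
        (FiberBundle.mem_baseSet_trivializationAt' z)
      rw [← c.apply_symm_apply k, hv (c.symm k), map_zero]
    have hu : u (𝔉.back z) = 0 := by
      let c := (trivializationAt K F (𝔉.back z)).continuousLinearEquivAt ℝ (𝔉.back z)
        (FiberBundle.mem_baseSet_trivializationAt' _)
      exact c.injective ((hK _).trans (map_zero c).symm)
    rw [𝔉.act_apply, hu]
    have := 𝔉.vec_smul (𝔉.back z) 0 0
    rw [smul_zero, zero_smul] at this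
    rw [this]
    exact map_zero (mfderiv (𝓡 n) 𝓘(ℝ, ℝ) f _)

/-- The generalized Lie algebra of smooth sections of `F` with the anchor
`Γ(Th ∘ ρ, h ∘ η)`. -/
noncomputable def sections [T2Space N] [ContMDiffVectorBundle ∞ K F (𝓡 n)] :
    GenLieAlgebra C^∞⟮𝓡 n, N; 𝓘(ℝ, ℝ), ℝ⟯ Cₛ^∞⟮𝓡 n; K, F⟯ where
  anchor :=
    { toFun := fun u => Derivation.mk' (AddMonoidHom.mk' (𝔉.act u) (𝔉.act_add u)).toIntLinearMap
        (fun f g => 𝔉.act_mul u f g)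
      map_add' := fun u v => Derivation.ext fun f => 𝔉.act_add_left u v f
      map_smul' := fun g u => Derivation.ext fun f => 𝔉.act_smul g u f }
  bracket := 𝔉.bracket
  add_bracket := 𝔉.add_bracket
  bracket_add := 𝔉.bracket_add
  bracket_self := 𝔉.bracket_self
  jacobi := 𝔉.jacobi
  leibniz := 𝔉.leibniz

end GenLieAlgebroid

end Algebroid

section PullBack

variable {m n : ℕ} {M N : Type*} [TopologicalSpace M]
    [ChartedSpace (EuclideanSpace ℝ (Fin m)) M] [TopologicalSpace N]
    [ChartedSpace (EuclideanSpace ℝ (Fin n)) N] [IsManifold (𝓡 m) ∞ M]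
    {K : Type*} [NormedAddCommGroup K] [NormedSpace ℝ K]
    {F : N → Type*} [TopologicalSpace (Bundle.TotalSpace K F)] [∀ y, AddCommGroup (F y)]
    [∀ y, Module ℝ (F y)] [∀ y, TopologicalSpace (F y)] [FiberBundle K F]

namespace AnchorDiagram

/-- The diffeomorphism `h` as a bundled smooth map. -/
noncomputable def hMap (D : AnchorDiagram m n M N K F) : C^∞⟮𝓡 m, M; 𝓡 n, N⟯ :=
  ⟨D.h, D.h.contMDiff⟩

variable [VectorBundle ℝ K F] (D : AnchorDiagram m n M N K F)

/-- The function `f ∘ h` on `M`. -/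
noncomputable def pullFun (f : C^∞⟮𝓡 n, N; 𝓘(ℝ, ℝ), ℝ⟯) : C^∞⟮𝓡 m, M; 𝓘(ℝ, ℝ), ℝ⟯ :=
  ⟨fun x => f (D.h x), f.contMDiff.comp D.h.contMDiff⟩

/-- The function `f ∘ h⁻¹` on `N`. -/
noncomputable def pushFun (f : C^∞⟮𝓡 m, M; 𝓘(ℝ, ℝ), ℝ⟯) : C^∞⟮𝓡 n, N; 𝓘(ℝ, ℝ), ℝ⟯ :=
  ⟨fun y => f (D.h.symm y), f.contMDiff.comp D.h.symm.contMDiff⟩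

@[simp] theorem pullFun_apply (f : C^∞⟮𝓡 n, N; 𝓘(ℝ, ℝ), ℝ⟯) (x : M) :
    D.pullFun f x = f (D.h x) := rfl

@[simp] theorem pushFun_apply (f : C^∞⟮𝓡 m, M; 𝓘(ℝ, ℝ), ℝ⟯) (y : N) :
    D.pushFun f y = f (D.h.symm y) := rfl

/-- The section `u ∘ h` of the pull-back bundle. -/
noncomputable def pull (u : Cₛ^∞⟮𝓡 n; K, F⟯) : Cₛ^∞⟮𝓡 m; K, D.hMap *ᵖ F⟯ :=
  ⟨fun x => u (D.h x), fun x => (contMDiffAt_pullback_iff D.hMap (fun x => u (D.h x)) x).2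
    ((u.contMDiff.comp D.h.contMDiff) x)⟩

/-- The section `s ∘ h⁻¹` of `F` defined by a section of the pull-back bundle. -/
noncomputable def push (s : Cₛ^∞⟮𝓡 m; K, D.hMap *ᵖ F⟯) : Cₛ^∞⟮𝓡 n; K, F⟯ :=
  ⟨fun y => cast (congrArg F (D.h.apply_symm_apply y)) (s (D.h.symm y)), by
    have h1 : ContMDiff (𝓡 m) ((𝓡 n).prod 𝓘(ℝ, K)) ∞
        (fun x => (⟨D.h x, s x⟩ : Bundle.TotalSpace K F)) := fun x =>
      (contMDiffAt_pullback_iff D.hMap (fun x => s x) x).1 (s.contMDiff x)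
    have h2 := h1.comp D.h.symm.contMDiff
    refine h2.congr fun y => ?_
    have h3 : ∀ {a b : N} (hab : a = b) (v : F a),
        (⟨b, cast (congrArg F hab) v⟩ : Bundle.TotalSpace K F) = ⟨a, v⟩ := by
      rintro a b rfl v
      rfl
    exact h3 (D.h.apply_symm_apply y) (s (D.h.symm y))⟩

theorem push_h_apply (s : Cₛ^∞⟮𝓡 m; K, D.hMap *ᵖ F⟯) (x : M) : D.push s (D.h x) = s x := by
  have h : ∀ {a b : M} (hab : a = b) (e : D.h a = D.h b),
      cast (congrArg F e) (s a : F (D.h a)) = s b := by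
    rintro a b rfl e
    rfl
  exact h (D.h.symm_apply_apply x) (D.h.apply_symm_apply _)

theorem ext_h {u v : Cₛ^∞⟮𝓡 n; K, F⟯} (h : ∀ x, u (D.h x) = v (D.h x)) : u = v := by
  ext y
  obtain ⟨x, rfl⟩ := D.h.surjective y
  exact h x

theorem push_pull (u : Cₛ^∞⟮𝓡 n; K, F⟯) : D.push (D.pull u) = u :=
  D.ext_h fun x => D.push_h_apply (D.pull u) x

theorem push_add (s t : Cₛ^∞⟮𝓡 m; K, D.hMap *ᵖ F⟯) :
    D.push (s + t) = D.push s + D.push t :=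
  D.ext_h fun x => (D.push_h_apply (s + t) x).trans
    (congrArg₂ (fun a b : F (D.h x) => a + b) (D.push_h_apply s x) (D.push_h_apply t x)).symm

theorem push_smul (f : C^∞⟮𝓡 m, M; 𝓘(ℝ, ℝ), ℝ⟯) (s : Cₛ^∞⟮𝓡 m; K, D.hMap *ᵖ F⟯) :
    D.push (f • s) = D.pushFun f • D.push s :=
  D.ext_h fun x => (D.push_h_apply (f • s) x).trans
    (congrArg₂ (fun (a : ℝ) (b : F (D.h x)) => a • b)
      (congrArg f (D.h.symm_apply_apply x)) (D.push_h_apply s x)).symm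

theorem pushFun_add (f g : C^∞⟮𝓡 m, M; 𝓘(ℝ, ℝ), ℝ⟯) :
    D.pushFun (f + g) = D.pushFun f + D.pushFun g := rfl

theorem pushFun_mul (f g : C^∞⟮𝓡 m, M; 𝓘(ℝ, ℝ), ℝ⟯) :
    D.pushFun (f * g) = D.pushFun f * D.pushFun g := rfl

theorem pull_push (s : Cₛ^∞⟮𝓡 m; K, D.hMap *ᵖ F⟯) : D.pull (D.push s) = s := by
  ext x
  exact D.push_h_apply s x

theorem pullFun_pushFun (f : C^∞⟮𝓡 m, M; 𝓘(ℝ, ℝ), ℝ⟯) : D.pullFun (D.pushFun f) = f := by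
  ext x
  exact congrArg f (D.h.symm_apply_apply x)

theorem pull_zero : D.pull 0 = 0 := rfl

theorem pull_add (u v : Cₛ^∞⟮𝓡 n; K, F⟯) : D.pull (u + v) = D.pull u + D.pull v := rfl

theorem pull_smul (f : C^∞⟮𝓡 n, N; 𝓘(ℝ, ℝ), ℝ⟯) (u : Cₛ^∞⟮𝓡 n; K, F⟯) :
    D.pull (f • u) = D.pullFun f • D.pull u := rfl

theorem pullFun_add (f g : C^∞⟮𝓡 n, N; 𝓘(ℝ, ℝ), ℝ⟯) :
    D.pullFun (f + g) = D.pullFun f + D.pullFun g := rfl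

theorem pullFun_mul (f g : C^∞⟮𝓡 n, N; 𝓘(ℝ, ℝ), ℝ⟯) :
    D.pullFun (f * g) = D.pullFun f * D.pullFun g := rfl

end AnchorDiagram

namespace GenLieAlgebroid

variable [VectorBundle ℝ K F] [IsManifold (𝓡 n) ∞ N] [T2Space N] [ContMDiffVectorBundle ∞ K F (𝓡 n)]
  (𝔉 : GenLieAlgebroid m n M N K F)

/-- The bracket of the pull-back Lie algebroid, characterized by `[u ∘ h, v ∘ h] = [u, v] ∘ h`. -/
noncomputable def pullBackBracket (s t : Cₛ^∞⟮𝓡 m; K, 𝔉.hMap *ᵖ F⟯) :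
    Cₛ^∞⟮𝓡 m; K, 𝔉.hMap *ᵖ F⟯ :=
  𝔉.pull (𝔉.sections.bracket (𝔉.push s) (𝔉.push t))

/-- The anchor of the pull-back Lie algebroid, characterized by `(u ∘ h)(f ∘ h) = u(f) ∘ h`. -/
noncomputable def pullBackAnchor (s : Cₛ^∞⟮𝓡 m; K, 𝔉.hMap *ᵖ F⟯) :
    Derivation ℤ C^∞⟮𝓡 m, M; 𝓘(ℝ, ℝ), ℝ⟯ C^∞⟮𝓡 m, M; 𝓘(ℝ, ℝ), ℝ⟯ :=
  Derivation.mk' (AddMonoidHom.mk'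
      (fun f => 𝔉.pullFun (𝔉.sections.anchor (𝔉.push s) (𝔉.pushFun f)))
      (fun f g => by rw [𝔉.pushFun_add, map_add, 𝔉.pullFun_add])).toIntLinearMap
    (fun f g => by
      have h : 𝔉.pullFun (𝔉.sections.anchor (𝔉.push s) (𝔉.pushFun (f * g))) =
          f * 𝔉.pullFun (𝔉.sections.anchor (𝔉.push s) (𝔉.pushFun g)) +
          g * 𝔉.pullFun (𝔉.sections.anchor (𝔉.push s) (𝔉.pushFun f)) := by
        rw [𝔉.pushFun_mul, Derivation.leibniz, 𝔉.pullFun_add, smul_eq_mul, smul_eq_mul,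
          𝔉.pullFun_mul, 𝔉.pullFun_mul, 𝔉.pullFun_pushFun, 𝔉.pullFun_pushFun]
      exact h)

theorem pullBackAnchor_apply (s : Cₛ^∞⟮𝓡 m; K, 𝔉.hMap *ᵖ F⟯) (f : C^∞⟮𝓡 m, M; 𝓘(ℝ, ℝ), ℝ⟯) :
    𝔉.pullBackAnchor s f = 𝔉.pullFun (𝔉.sections.anchor (𝔉.push s) (𝔉.pushFun f)) := rfl

/-- The pull-back Lie algebroid, on the bundle `h^*F` over `M`. -/
noncomputable def pullBack : GenLieAlgebra C^∞⟮𝓡 m, M; 𝓘(ℝ, ℝ), ℝ⟯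
    Cₛ^∞⟮𝓡 m; K, 𝔉.hMap *ᵖ F⟯ where
  anchor :=
    { toFun := 𝔉.pullBackAnchor
      map_add' := fun s t => Derivation.ext fun f => by
        rw [Derivation.add_apply, 𝔉.pullBackAnchor_apply, 𝔉.pullBackAnchor_apply,
          𝔉.pullBackAnchor_apply, 𝔉.push_add, map_add, Derivation.add_apply, 𝔉.pullFun_add]
      map_smul' := fun g s => Derivation.ext fun f => by
        rw [RingHom.id_apply, Derivation.smul_apply, 𝔉.pullBackAnchor_apply,
          𝔉.pullBackAnchor_apply, 𝔉.push_smul, map_smul, Derivation.smul_apply, smul_eq_mul,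
          smul_eq_mul, 𝔉.pullFun_mul, 𝔉.pullFun_pushFun] }
  bracket := 𝔉.pullBackBracket
  add_bracket u v w := by
    simp only [pullBackBracket]
    rw [𝔉.push_add, GenLieAlgebra.add_bracket, 𝔉.pull_add]
  bracket_add u v w := by
    simp only [pullBackBracket]
    rw [𝔉.push_add, GenLieAlgebra.bracket_add, 𝔉.pull_add]
  bracket_self u := by
    simp only [pullBackBracket]
    rw [GenLieAlgebra.bracket_self, 𝔉.pull_zero]
  jacobi u v w := by
    simp only [pullBackBracket]
    rw [𝔉.push_pull, 𝔉.push_pull, 𝔉.push_pull, ← 𝔉.pull_add, ← 𝔉.pull_add,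
      GenLieAlgebra.jacobi, 𝔉.pull_zero]
  leibniz u f v := by
    simp only [pullBackBracket]
    change _ = _ + 𝔉.pullBackAnchor u f • v
    rw [𝔉.pullBackAnchor_apply, 𝔉.push_smul, GenLieAlgebra.leibniz, 𝔉.pull_add, 𝔉.pull_smul,
      𝔉.pull_smul, 𝔉.pullFun_pushFun, 𝔉.pull_push]

end GenLieAlgebroid

end PullBack

section Systems

variable {n : ℕ} {B : Type*} [TopologicalSpace B] [ChartedSpace (EuclideanSpace ℝ (Fin n)) B]
  {K : Type*} [NormedAddCommGroup K] [NormedSpace ℝ K]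
  {V : B → Type*} [TopologicalSpace (Bundle.TotalSpace K V)] [∀ x, AddCommGroup (V x)]
  [∀ x, Module ℝ (V x)] [∀ x, TopologicalSpace (V x)] [FiberBundle K V] [VectorBundle ℝ K V]

/-- A smooth vector subbundle: a family of linear subspaces of the fibres which, near every point,
is spanned by finitely many smooth, pointwise linearly independent local sections. -/
structure Subbundle (n : ℕ) {B : Type*} [TopologicalSpace B]
    [ChartedSpace (EuclideanSpace ℝ (Fin n)) B] (K : Type*) [NormedAddCommGroup K]
    [NormedSpace ℝ K] (V : B → Type*) [TopologicalSpace (Bundle.TotalSpace K V)]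
    [∀ x, AddCommGroup (V x)] [∀ x, Module ℝ (V x)] [∀ x, TopologicalSpace (V x)]
    [FiberBundle K V] where
  fiber : ∀ x, Submodule ℝ (V x)
  exists_frame : ∀ x₀ : B, ∃ W : Set B, IsOpen W ∧ x₀ ∈ W ∧ ∃ (r : ℕ) (s : Fin r → ∀ x, V x),
    (∀ i, ContMDiffOn (𝓡 n) ((𝓡 n).prod 𝓘(ℝ, K)) ∞
      (fun x => (⟨x, s i x⟩ : Bundle.TotalSpace K V)) W) ∧
    ∀ x ∈ W, LinearIndependent ℝ (fun i => s i x) ∧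
      Submodule.span ℝ (Set.range fun i => s i x) = fiber x

/-- The module of global smooth sections of a subbundle. -/
noncomputable def Subbundle.sections (E : Subbundle n K V) :
    Submodule C^∞⟮𝓡 n, B; 𝓘(ℝ, ℝ), ℝ⟯ Cₛ^∞⟮𝓡 n; K, V⟯ where
  carrier := {s | ∀ x, s x ∈ E.fiber x}
  add_mem' hs ht x := (E.fiber x).add_mem (hs x) (ht x)
  zero_mem' x := (E.fiber x).zero_mem
  smul_mem' f _ hs x := (E.fiber x).smul_mem (f x) (hs x)

/-- The module of smooth sections of a subbundle over an open set `U`. -/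
noncomputable def Subbundle.sectionsOn (E : Subbundle n K V) (U : TopologicalSpace.Opens B) :
    Submodule C^∞⟮𝓡 n, U; 𝓘(ℝ, ℝ), ℝ⟯ Cₛ^∞⟮𝓡 n; K, inclMap n B U *ᵖ V⟯ where
  carrier := {s | ∀ x : U, (s x : V x.1) ∈ E.fiber x.1}
  add_mem' hs ht x := (E.fiber x.1).add_mem (hs x) (ht x)
  zero_mem' x := (E.fiber x.1).zero_mem
  smul_mem' f _ hs x := (E.fiber x.1).smul_mem (f x) (hs x)

/-- The sections over `U` of the annihilator bundle: the one-forms over `U` which vanish on the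
sections of the subbundle over `U`. -/
noncomputable def Subbundle.annihilatorOn (E : Subbundle n K V) (U : TopologicalSpace.Opens B) :
    Submodule C^∞⟮𝓡 n, U; 𝓘(ℝ, ℝ), ℝ⟯
      (Module.Dual C^∞⟮𝓡 n, U; 𝓘(ℝ, ℝ), ℝ⟯ Cₛ^∞⟮𝓡 n; K, inclMap n B U *ᵖ V⟯) :=
  (E.sectionsOn U).dualAnnihilator

/-- The ideal of the exterior algebra over `U` generated by the sections over `U` of the
annihilator bundle. -/
noncomputable def Subbundle.annihilatorIdealOn (E : Subbundle n K V) (U : TopologicalSpace.Opens B) :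
    Submodule C^∞⟮𝓡 n, U; 𝓘(ℝ, ℝ), ℝ⟯
      (ExtForms C^∞⟮𝓡 n, U; 𝓘(ℝ, ℝ), ℝ⟯ Cₛ^∞⟮𝓡 n; K, inclMap n B U *ᵖ V⟯) :=
  extIdealSpan (oneForm '' (E.annihilatorOn U : Set
    (Module.Dual C^∞⟮𝓡 n, U; 𝓘(ℝ, ℝ), ℝ⟯ Cₛ^∞⟮𝓡 n; K, inclMap n B U *ᵖ V⟯)))

end Systems

section AlgebroidSystems

variable {m n : ℕ} {M N : Type*} [TopologicalSpace M]
    [ChartedSpace (EuclideanSpace ℝ (Fin m)) M] [TopologicalSpace N]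
    [ChartedSpace (EuclideanSpace ℝ (Fin n)) N] [IsManifold (𝓡 m) ∞ M] [IsManifold (𝓡 n) ∞ N]
    {K : Type*} [NormedAddCommGroup K] [NormedSpace ℝ K]
    {F : N → Type*} [TopologicalSpace (Bundle.TotalSpace K F)] [∀ y, AddCommGroup (F y)]
    [∀ y, Module ℝ (F y)] [∀ y, TopologicalSpace (F y)] [FiberBundle K F] [VectorBundle ℝ K F]

/-- An interior differential system of a generalized Lie algebroid: a vector subbundle of the
pull-back bundle `h^*F`. -/
abbrev GenLieAlgebroid.InteriorSystem (𝔉 : GenLieAlgebroid m n M N K F) : Type _ :=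
  Subbundle m K (𝔉.hMap *ᵖ F)

variable [T2Space N] [ContMDiffVectorBundle ∞ K F (𝓡 n)]

/-- An interior differential system is involutive if its sections are closed under the bracket of
the pull-back Lie algebroid. -/
def GenLieAlgebroid.IsInvolutive (𝔉 : GenLieAlgebroid m n M N K F) (E : 𝔉.InteriorSystem) : Prop :=
  ∀ S ∈ E.sections, ∀ T ∈ E.sections, 𝔉.pullBack.bracket S T ∈ E.sections

variable [T2Space M]

/-- An exterior differential system over an open set `U`: a differential ideal `I` of the exterior
algebra of the pull-back Lie algebroid over `U` such that, for some interior differential system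
`E'`, all forms of positive degree in `I` vanish on the sections of `E'` over `U`. -/
def GenLieAlgebroid.IsExteriorSystemOn (𝔉 : GenLieAlgebroid m n M N K F)
    (U : TopologicalSpace.Opens M)
    (I : Submodule C^∞⟮𝓡 m, U; 𝓘(ℝ, ℝ), ℝ⟯
      (ExtForms C^∞⟮𝓡 m, U; 𝓘(ℝ, ℝ), ℝ⟯ Cₛ^∞⟮𝓡 m; K, inclMap m M U *ᵖ (𝔉.hMap *ᵖ F)⟯)) : Prop :=
  (𝔉.pullBack.restrict U).IsDifferentialIdeal I ∧
  ∃ E' : 𝔉.InteriorSystem, ∀ k : ℕ, 1 ≤ k →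
    ∀ θ : Cₛ^∞⟮𝓡 m; K, inclMap m M U *ᵖ (𝔉.hMap *ᵖ F)⟯ [⋀^Fin k]→ₗ[C^∞⟮𝓡 m, U; 𝓘(ℝ, ℝ), ℝ⟯]
      C^∞⟮𝓡 m, U; 𝓘(ℝ, ℝ), ℝ⟯,
    DirectSum.of (fun q => Cₛ^∞⟮𝓡 m; K, inclMap m M U *ᵖ (𝔉.hMap *ᵖ F)⟯
      [⋀^Fin q]→ₗ[C^∞⟮𝓡 m, U; 𝓘(ℝ, ℝ), ℝ⟯] C^∞⟮𝓡 m, U; 𝓘(ℝ, ℝ), ℝ⟯) k θ ∈ I →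
    ∀ u : Fin k → Cₛ^∞⟮𝓡 m; K, inclMap m M U *ᵖ (𝔉.hMap *ᵖ F)⟯,
      (∀ i, u i ∈ E'.sectionsOn U) → θ u = 0

end AlgebroidSystems

/-!
If `α` is an alternating form, `f` an endomorphism, `θ` a one-form and `e` a section, then
`α ∘ (f + θ ⊗ e) = α ∘ f ± (ι_e α ∘ f) ∧ θ`. Write the identity as `f + ∑ i, θ i ⊗ e i`, with `f`
valued in the sections of `E` and the `θ i` in the annihilator of `E`: a form vanishing on `E`
satisfies `α ∘ f = 0`, so it lies in the ideal generated by the annihilator. That ideal therefore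
consists of all the forms vanishing on `E`, and it is closed under `d` exactly when the sections of
`E` are closed under the bracket, by `dθ(s, t) = s(θ t) - t(θ s) - θ [s, t]`.

Such a decomposition of the identity exists as soon as `Γ(V|U) / Γ(E|U)` is finitely generated and
projective. A frame of `V` over `U` provides a Euclidean metric on the fibres; if the columns of `C`
are the coordinates of a local frame of `E`, the orthogonal projection onto `E` has the smooth
matrix `C (Cᵀ C)⁻¹ Cᵀ`, so that `E` has a complement. Finally, by means of bump functions,
involutivity can be tested on an open cover.
-/

section ExteriorForms

variable {R A : Type*} [CommRing R] [AddCommGroup A] [Module R A]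

/-- The inclusion of the forms of degree `k` into the exterior algebra. -/
abbrev ExtForms.ofDegree (k : ℕ) : A [⋀^Fin k]→ₗ[R] R →ₗ[R] ExtForms R A :=
  DirectSum.lof R ℕ (fun q => A [⋀^Fin q]→ₗ[R] R) k

theorem ExtForms.exists_sum_ofDegree_eq (α : ExtForms R A) :
    ∃ s : Finset ℕ, ∑ k ∈ s, ExtForms.ofDegree k (α k) = α := by
  classical
  exact ⟨_, DirectSum.sum_support_of α⟩

theorem ExtForms.mem_of_forall_ofDegree_mem {I : Submodule R (ExtForms R A)} {α : ExtForms R A}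
    (h : ∀ k, ExtForms.ofDegree k (α k) ∈ I) : α ∈ I := by
  obtain ⟨s, hs⟩ := α.exists_sum_ofDegree_eq
  exact hs ▸ I.sum_mem fun k _ => h k

theorem extWedge_mem_of_forall_wedgeForm_mem {I : Submodule R (ExtForms R A)} {α β : ExtForms R A}
    (h : ∀ q r, ExtForms.ofDegree (q + r) (wedgeForm q r (α q) (β r)) ∈ I) :
    extWedge α β ∈ I := by
  obtain ⟨s, hs⟩ := α.exists_sum_ofDegree_eq
  obtain ⟨t, ht⟩ := β.exists_sum_ofDegree_eq
  rw [← hs, ← ht, LinearMap.map_sum₂]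
  refine I.sum_mem fun q _ => ?_
  rw [map_sum]
  exact I.sum_mem fun r _ => (extWedge_of (α q) (β r)).symm ▸ h q r

theorem GenLieAlgebra.extDiff_ofDegree (L : GenLieAlgebra R A) {k : ℕ} (α : A [⋀^Fin k]→ₗ[R] R) :
    L.extDiff (ExtForms.ofDegree k α) = ExtForms.ofDegree (k + 1) (L.extDer α) :=
  (DirectSum.toAddMonoid_of (β := fun q => A [⋀^Fin q]→ₗ[R] R) _ k α).trans rfl

theorem GenLieAlgebra.extDiff_mem_of_forall_extDer_mem (L : GenLieAlgebra R A)
    {I : Submodule R (ExtForms R A)} {α : ExtForms R A}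
    (h : ∀ k, ExtForms.ofDegree (k + 1) (L.extDer (α k)) ∈ I) : L.extDiff α ∈ I := by
  obtain ⟨s, hs⟩ := α.exists_sum_ofDegree_eq
  rw [← hs, map_sum]
  exact I.sum_mem fun k _ => (L.extDiff_ofDegree (α k)).symm ▸ h k

/-- The permutation of `Fin k ⊕ Fin 1 ≃ Fin (k + 1)` which moves the last index to `p` and keeps
the order of the other ones: the shuffles of type `(k, 1)`, indexed by `p`. -/
def lastShuffle {k : ℕ} (p : Fin (k + 1)) : Equiv.Perm (Fin k ⊕ Fin 1) :=
  finSumFinEquiv.symm.permCongr ((finRotate (k + 1)).trans p.cycleRange.symm)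

theorem finSumFinEquiv_lastShuffle_inl {k : ℕ} (p : Fin (k + 1)) (i : Fin k) :
    finSumFinEquiv (lastShuffle p (Sum.inl i)) = p.succAbove i := by
  have hi : finRotate (k + 1) (Fin.castAdd 1 i) = i.succ := by
    rw [finRotate_apply]
    exact Fin.coeSucc_eq_succ
  simp [lastShuffle, Equiv.permCongr_apply, hi, -finRotate_apply]

theorem finSumFinEquiv_lastShuffle_inr {k : ℕ} (p : Fin (k + 1)) (i : Fin 1) :
    finSumFinEquiv (lastShuffle p (Sum.inr i)) = p := by
  obtain rfl := Subsingleton.elim i 0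
  have hlast : Fin.natAdd k (0 : Fin 1) = Fin.last k := rfl
  simp [lastShuffle, Equiv.permCongr_apply, hlast]

theorem sign_lastShuffle {k : ℕ} (p : Fin (k + 1)) :
    Equiv.Perm.sign (lastShuffle p) = (-1) ^ k * (-1) ^ (p : ℕ) := by
  rw [lastShuffle, Equiv.Perm.sign_permCongr, Equiv.Perm.sign_trans, Equiv.Perm.sign_symm,
    sign_finRotate, Fin.sign_cycleRange, mul_comm, add_tsub_cancel_right]

theorem bijective_mk_lastShuffle (k : ℕ) : Function.Bijective fun p : Fin (k + 1) =>
    (Quotient.mk'' (lastShuffle p) : Equiv.Perm.ModSumCongr (Fin k) (Fin 1)) := by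
  constructor
  · intro p q h
    obtain ⟨⟨l, r⟩, hlr⟩ := QuotientGroup.leftRel_apply.1 (Quotient.exact' h)
    have hpq : lastShuffle q (Sum.inr 0) = lastShuffle p (Sum.inr (r 0)) := by
      rw [inv_mul_eq_iff_eq_mul.1 hlr.symm]
      rfl
    simpa only [finSumFinEquiv_lastShuffle_inr] using (congrArg finSumFinEquiv hpq).symm
  · intro σ
    induction σ using Quotient.inductionOn' with | _ σ
    refine ⟨finSumFinEquiv (σ (Sum.inr 0)), Quotient.sound' (QuotientGroup.leftRel_apply.2 ?_)⟩
    set τ := lastShuffle (finSumFinEquiv (σ (Sum.inr 0))) with hτ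
    have hτσ : τ⁻¹ (σ (Sum.inr 0)) = Sum.inr 0 := by
      rw [Equiv.Perm.inv_eq_iff_eq, hτ, ← finSumFinEquiv.injective.eq_iff,
        finSumFinEquiv_lastShuffle_inr]
    refine Equiv.Perm.mem_sumCongrHom_range_of_perm_mapsTo_inl ?_
    rintro _ ⟨i, rfl⟩
    rcases h : (τ⁻¹ * σ) (Sum.inl i) with j | j
    · exact ⟨j, rfl⟩
    · rw [Subsingleton.elim j 0, ← hτσ] at h
      simp at h

open AlternatingMap hiding add_apply smul_apply

theorem mul'_domCoprod_summand {q r : ℕ} (α : A [⋀^Fin q]→ₗ[R] R) (β : A [⋀^Fin r]→ₗ[R] R)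
    (σ : Equiv.Perm (Fin q ⊕ Fin r)) (v : Fin q ⊕ Fin r → A) :
    LinearMap.mul' R R (domCoprod.summand α β (Quotient.mk'' σ) v) =
      (Equiv.Perm.sign σ : ℤ) *
        (α (fun i => v (σ (Sum.inl i))) * β fun i => v (σ (Sum.inr i))) := by
  rw [domCoprod.summand_mk'', smul_apply, MultilinearMap.domDomCongr_apply,
    MultilinearMap.domCoprod_apply, Units.smul_def, map_zsmul, LinearMap.mul'_apply, zsmul_eq_mul]
  rfl

theorem wedgeForm_one_apply {k : ℕ} (β : A [⋀^Fin k]→ₗ[R] R) (θ : Module.Dual R A)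
    (z : Fin (k + 1) → A) :
    wedgeForm k 1 β (ofSubsingleton R A R 0 θ) z =
      (-1) ^ k * ∑ p : Fin (k + 1), (-1) ^ (p : ℕ) * (θ (z p) * β (p.removeNth z)) := by
  rw [wedgeForm_apply, domDomCongr_apply, LinearMap.compAlternatingMap_apply, domCoprod_apply,
    sum_apply, map_sum, Finset.mul_sum]
  refine (Fintype.sum_bijective _ (bijective_mk_lastShuffle k) _ _ fun p => ?_).symm
  have hz : (fun i => z (p.succAbove i)) = p.removeNth z := rfl
  rw [mul'_domCoprod_summand, sign_lastShuffle]
  simp only [Function.comp_apply, finSumFinEquiv_lastShuffle_inl, finSumFinEquiv_lastShuffle_inr,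
    hz, ofSubsingleton_apply_apply]
  push_cast
  ring

theorem alternatingMap_piecewise_smul_eq_zero {k : ℕ} (α : A [⋀^Fin k]→ₗ[R] R) (c : Fin k → R)
    (e : A) (z : Fin k → A) {s : Finset (Fin k)} (hs : 2 ≤ s.card) :
    α (s.piecewise (fun i => c i • e) z) = 0 := by
  obtain ⟨i, hi, j, hj, hij⟩ := Finset.one_lt_card.1 hs
  set w := s.piecewise (fun _ => e) z with hw
  have hcw : s.piecewise (fun i => c i • e) z = s.piecewise (fun i => c i • w i) w := by
    ext l
    by_cases hl : l ∈ s <;> simp [hw, hl]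
  have hwij : w i = w j := by simp [hw, hi, hj]
  rw [hcw, ← coe_multilinearMap, MultilinearMap.map_piecewise_smul, coe_multilinearMap,
    α.map_eq_zero_of_eq w hwij hij, smul_zero]

theorem alternatingMap_add_smul {k : ℕ} (α : A [⋀^Fin (k + 1)]→ₗ[R] R) (c : Fin (k + 1) → R)
    (e : A) (z : Fin (k + 1) → A) :
    α (z + fun i => c i • e) =
      α z + ∑ p : Fin (k + 1), (-1) ^ (p : ℕ) * (c p * α.curryLeft e (p.removeNth z)) := by
  rw [← coe_multilinearMap, MultilinearMap.map_add_eq_map_add_linearDeriv_add,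
    MultilinearMap.linearDeriv_apply, coe_multilinearMap,
    Finset.sum_eq_zero fun s hs =>
      alternatingMap_piecewise_smul_eq_zero α c e z (Finset.mem_filter.1 hs).2, add_zero]
  refine congrArg (α z + ·) (Finset.sum_congr rfl fun p _ => ?_)
  rw [map_update_smul, ← Fin.insertNth_removeNth, map_insertNth, curryLeft_apply_apply,
    smul_eq_mul, zsmul_eq_mul]
  push_cast
  ring

theorem compLinearMap_add_smulRight {k : ℕ} (α : A [⋀^Fin (k + 1)]→ₗ[R] R) (f : A →ₗ[R] A)
    (θ : Module.Dual R A) (e : A) :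
    α.compLinearMap (f + θ.smulRight e) = α.compLinearMap f + (-1 : R) ^ k •
      wedgeForm k 1 ((α.curryLeft e).compLinearMap f) (ofSubsingleton R A R 0 θ) := by
  ext z
  have hz : (fun i => (f + θ.smulRight e) (z i)) = (fun i => f (z i)) + fun i => θ (z i) • e := rfl
  rw [compLinearMap_apply, hz, alternatingMap_add_smul, AlternatingMap.add_apply,
    AlternatingMap.smul_apply, wedgeForm_one_apply, smul_eq_mul, ← mul_assoc, ← pow_add,
    Even.neg_one_pow ⟨k, rfl⟩, one_mul]
  rfl

theorem ofDegree_compLinearMap_add_smulRight_smodEq {I : Submodule R (ExtForms R A)}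
    (hI : IsExtIdeal I) {θ : Module.Dual R A} (hθ : oneForm θ ∈ I) {k : ℕ}
    (α : A [⋀^Fin k]→ₗ[R] R) (f : A →ₗ[R] A) (e : A) :
    ExtForms.ofDegree k (α.compLinearMap (f + θ.smulRight e)) ≡
      ExtForms.ofDegree k (α.compLinearMap f) [SMOD I] := by
  cases k with
  | zero =>
    have h : α.compLinearMap (f + θ.smulRight e) = α.compLinearMap f :=
      AlternatingMap.ext fun z => congrArg α (Subsingleton.elim _ _)
    rw [h]
  | succ k =>
    have h := hI.wedge_mem_left (ExtForms.ofDegree k ((α.curryLeft e).compLinearMap f)) _ hθ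
    rw [oneForm, ← DirectSum.lof_eq_of R, extWedge_of] at h
    rw [compLinearMap_add_smulRight, map_add, map_smul]
    exact (SModEq.rfl.add (SModEq.zero.2 (I.smul_mem _ h))).trans (by rw [add_zero])

theorem ofDegree_compLinearMap_add_sum_smodEq {I : Submodule R (ExtForms R A)}
    (hI : IsExtIdeal I) {ι : Type*} {θ : ι → Module.Dual R A} (hθ : ∀ i, oneForm (θ i) ∈ I)
    (e : ι → A) {k : ℕ} (α : A [⋀^Fin k]→ₗ[R] R) (f : A →ₗ[R] A) (s : Finset ι) :
    ExtForms.ofDegree k (α.compLinearMap (f + ∑ i ∈ s, (θ i).smulRight (e i))) ≡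
      ExtForms.ofDegree k (α.compLinearMap f) [SMOD I] := by
  classical
  induction s using Finset.induction_on with
  | empty => rw [Finset.sum_empty, add_zero]
  | insert j s hj ih =>
    rw [Finset.sum_insert hj, add_comm ((θ j).smulRight (e j)), ← add_assoc]
    exact (ofDegree_compLinearMap_add_smulRight_smodEq hI (hθ j) α _ (e j)).trans ih

/-- The forms which vanish on the elements of a submodule, degree by degree. -/
def vanishingForms (𝓔 : Submodule R A) : Submodule R (ExtForms R A) where
  carrier := {α | ∀ (k : ℕ) (u : Fin k → A), (∀ i, u i ∈ 𝓔) → α k u = 0}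
  add_mem' := fun {α β} hα hβ k u hu => by
    rw [DirectSum.add_apply, AlternatingMap.add_apply, hα k u hu, hβ k u hu, add_zero]
  zero_mem' := fun k u _ => by rw [DirectSum.zero_apply, AlternatingMap.zero_apply]
  smul_mem' := fun c α hα k u hu => by
    rw [DirectSum.smul_apply, AlternatingMap.smul_apply, hα k u hu, smul_zero]

variable {𝓔 : Submodule R A}

theorem ofDegree_mem_vanishingForms {k : ℕ} {α : A [⋀^Fin k]→ₗ[R] R} :
    ExtForms.ofDegree k α ∈ vanishingForms 𝓔 ↔ ∀ u : Fin k → A, (∀ i, u i ∈ 𝓔) → α u = 0 := by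
  refine ⟨fun h u hu => ?_, fun h l u hu => ?_⟩
  · simpa only [DirectSum.lof_apply] using h k u hu
  · rcases eq_or_ne k l with rfl | hkl
    · rw [DirectSum.lof_apply]
      exact h u hu
    · rw [DirectSum.lof_eq_of, DirectSum.of_eq_of_ne _ _ _ hkl.symm, AlternatingMap.zero_apply]

theorem wedgeForm_eq_zero {q r : ℕ} {α : A [⋀^Fin q]→ₗ[R] R} {β : A [⋀^Fin r]→ₗ[R] R}
    {z : Fin (q + r) → A}
    (h : ∀ σ : Equiv.Perm (Fin q ⊕ Fin r), (α fun i => z (finSumFinEquiv (σ (Sum.inl i)))) *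
      (β fun i => z (finSumFinEquiv (σ (Sum.inr i)))) = 0) :
    wedgeForm q r α β z = 0 := by
  rw [wedgeForm_apply, domDomCongr_apply, LinearMap.compAlternatingMap_apply, domCoprod_apply,
    sum_apply, map_sum]
  refine Finset.sum_eq_zero fun σ _ => ?_
  induction σ using Quotient.inductionOn' with | _ σ
  exact (mul'_domCoprod_summand α β σ _).trans (mul_eq_zero_of_right _ (h σ))

variable (𝓔) in
theorem isExtIdeal_vanishingForms : IsExtIdeal (vanishingForms 𝓔) where
  wedge_mem_left _ _ hα := extWedge_mem_of_forall_wedgeForm_mem fun _ r =>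
    ofDegree_mem_vanishingForms.2 fun _ hu => wedgeForm_eq_zero fun _ =>
      mul_eq_zero_of_right _ (hα r _ fun _ => hu _)
  wedge_mem_right _ _ hα := extWedge_mem_of_forall_wedgeForm_mem fun q _ =>
    ofDegree_mem_vanishingForms.2 fun _ hu => wedgeForm_eq_zero fun _ =>
      mul_eq_zero_of_left (hα q _ fun _ => hu _) _

theorem isExtIdeal_extIdealSpan (S : Set (ExtForms R A)) : IsExtIdeal (extIdealSpan S) where
  wedge_mem_left β α hα := Submodule.mem_sInf.2 fun I hI =>
    hI.1.wedge_mem_left β α (Submodule.mem_sInf.1 hα I hI)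
  wedge_mem_right β α hα := Submodule.mem_sInf.2 fun I hI =>
    hI.1.wedge_mem_right β α (Submodule.mem_sInf.1 hα I hI)

theorem subset_extIdealSpan (S : Set (ExtForms R A)) : S ⊆ extIdealSpan S :=
  fun _ hα => Submodule.mem_sInf.2 fun _ hI => hI.2 hα

theorem oneForm_mem_vanishingForms {θ : Module.Dual R A} (hθ : θ ∈ 𝓔.dualAnnihilator) :
    oneForm θ ∈ vanishingForms 𝓔 :=
  ofDegree_mem_vanishingForms.2 fun _ hu => (Submodule.mem_dualAnnihilator θ).1 hθ _ (hu 0)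

variable (𝓔) in
theorem extIdealSpan_dualAnnihilator_le_vanishingForms :
    extIdealSpan (oneForm '' (𝓔.dualAnnihilator : Set (Module.Dual R A))) ≤ vanishingForms 𝓔 :=
  sInf_le ⟨isExtIdeal_vanishingForms 𝓔,
    Set.image_subset_iff.2 fun _ hθ => oneForm_mem_vanishingForms hθ⟩

variable (𝓔) in
theorem exists_eq_add_sum_dualAnnihilator [Module.Finite R (A ⧸ 𝓔)] [Module.Projective R (A ⧸ 𝓔)] :
    ∃ (m : ℕ) (θ : Fin m → Module.Dual R A) (e : Fin m → A) (f : A →ₗ[R] A),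
      (∀ i, θ i ∈ 𝓔.dualAnnihilator) ∧ (∀ z, f z ∈ 𝓔) ∧
        f + ∑ i, (θ i).smulRight (e i) = LinearMap.id := by
  obtain ⟨m, p, j, -, -, hpj⟩ := Module.Finite.exists_comp_eq_id_of_projective R (A ⧸ 𝓔)
  choose e he using fun i => 𝓔.mkQ_surjective (p fun j => if i = j then 1 else 0)
  let θ : Fin m → Module.Dual R A := fun i => LinearMap.proj i ∘ₗ j ∘ₗ 𝓔.mkQ
  have hθe (z : A) : 𝓔.mkQ (∑ i, θ i z • e i) = 𝓔.mkQ z := by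
    have hz : p (j (𝓔.mkQ z)) = 𝓔.mkQ z := LinearMap.congr_fun hpj (𝓔.mkQ z)
    rw [← hz, LinearMap.pi_apply_eq_sum_univ p, map_sum]
    exact Finset.sum_congr rfl fun i _ => by rw [map_smul, he]; rfl
  refine ⟨m, θ, e, LinearMap.id - ∑ i, (θ i).smulRight (e i), fun i => ?_, fun z => ?_,
    sub_add_cancel _ _⟩
  · refine (Submodule.mem_dualAnnihilator _).2 fun z hz => ?_
    simp [θ, (Submodule.Quotient.mk_eq_zero 𝓔).2 hz]
  · rw [← Submodule.ker_mkQ 𝓔, LinearMap.mem_ker]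
    simpa only [LinearMap.sub_apply, LinearMap.id_apply, LinearMap.sum_apply,
      LinearMap.smulRight_apply, map_sub, sub_eq_zero] using (hθe z).symm

theorem mem_of_forall_dualAnnihilator [Module.Finite R (A ⧸ 𝓔)] [Module.Projective R (A ⧸ 𝓔)]
    {z : A} (h : ∀ θ ∈ 𝓔.dualAnnihilator, θ z = 0) : z ∈ 𝓔 := by
  obtain ⟨m, θ, e, f, hθ, hf, hfθ⟩ := exists_eq_add_sum_dualAnnihilator 𝓔
  have hz : f z + ∑ i, θ i z • e i = z := by
    simpa using LinearMap.congr_fun hfθ z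
  rw [← hz, Finset.sum_eq_zero fun i _ => by rw [h _ (hθ i), zero_smul], add_zero]
  exact hf z

variable (𝓔) in
theorem extIdealSpan_dualAnnihilator [Module.Finite R (A ⧸ 𝓔)] [Module.Projective R (A ⧸ 𝓔)] :
    extIdealSpan (oneForm '' (𝓔.dualAnnihilator : Set (Module.Dual R A))) = vanishingForms 𝓔 := by
  refine (extIdealSpan_dualAnnihilator_le_vanishingForms 𝓔).antisymm fun α hα => ?_
  obtain ⟨m, θ, e, f, hθ, hf, hfθ⟩ := exists_eq_add_sum_dualAnnihilator 𝓔
  refine ExtForms.mem_of_forall_ofDegree_mem fun k => ?_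
  have hαf : (α k).compLinearMap f = 0 := AlternatingMap.ext fun z => hα k _ fun i => hf (z i)
  have h := ofDegree_compLinearMap_add_sum_smodEq (isExtIdeal_extIdealSpan _)
    (fun i => subset_extIdealSpan _ (Set.mem_image_of_mem oneForm (hθ i))) e (α k) f Finset.univ
  rwa [hfθ, hαf, _root_.map_zero, compLinearMap_id, SModEq.zero] at h

namespace GenLieAlgebra

variable (L : GenLieAlgebra R A)

theorem extDiff_mem_vanishingForms (h𝓔 : ∀ s ∈ 𝓔, ∀ t ∈ 𝓔, L.bracket s t ∈ 𝓔) {α : ExtForms R A}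
    (hα : α ∈ vanishingForms 𝓔) : L.extDiff α ∈ vanishingForms 𝓔 := by
  refine L.extDiff_mem_of_forall_extDer_mem fun q => ofDegree_mem_vanishingForms.2 fun z hz => ?_
  have hαq := hα q
  generalize α q = β at hαq
  have hanchor : L.koszulAnchor β z = 0 := Finset.sum_eq_zero fun i _ => by
    rw [hαq (i.removeNth z) fun j => hz _, _root_.map_zero, mul_zero]
  have hbracket : L.koszulBracket β z = 0 := by
    cases q with
    | zero => rfl
    | succ q =>
      refine Finset.sum_eq_zero fun i _ => Finset.sum_eq_zero fun j _ => ?_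
      rw [hαq _ (Fin.cases (h𝓔 _ (hz _) _ (hz _)) fun _ => hz _), mul_zero]
  exact (congrArg₂ (· + ·) hanchor hbracket).trans (add_zero 0)

theorem extDer_ofSubsingleton_apply (θ : Module.Dual R A) (s t : A) :
    L.extDer (ofSubsingleton R A R 0 θ) ![s, t] =
      L.anchor s (θ t) - L.anchor t (θ s) - θ (L.bracket s t) := by
  change L.koszul _ _ = _
  simp [koszul, koszulAnchor, koszulBracket, Fin.sum_univ_two, Fin.removeNth, sub_eq_add_neg]

theorem apply_bracket_eq_zero_of_isDifferentialIdeal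
    (hI : L.IsDifferentialIdeal
      (extIdealSpan (oneForm '' (𝓔.dualAnnihilator : Set (Module.Dual R A)))))
    {s t : A} (hs : s ∈ 𝓔) (ht : t ∈ 𝓔) {θ : Module.Dual R A} (hθ : θ ∈ 𝓔.dualAnnihilator) :
    θ (L.bracket s t) = 0 := by
  have h := hI.extDiff_mem _ (subset_extIdealSpan _ ⟨θ, hθ, rfl⟩)
  rw [oneForm, ← DirectSum.lof_eq_of R, extDiff_ofDegree] at h
  have hst := ofDegree_mem_vanishingForms.1
    (extIdealSpan_dualAnnihilator_le_vanishingForms 𝓔 h) ![s, t]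
    (Fin.forall_fin_two.2 ⟨hs, ht⟩)
  have hs' : θ s = 0 := (Submodule.mem_dualAnnihilator θ).1 hθ s hs
  have ht' : θ t = 0 := (Submodule.mem_dualAnnihilator θ).1 hθ t ht
  simpa [extDer_ofSubsingleton_apply, hs', ht'] using hst

theorem isDifferentialIdeal_extIdealSpan_dualAnnihilator_iff
    [Module.Finite R (A ⧸ 𝓔)] [Module.Projective R (A ⧸ 𝓔)] :
    L.IsDifferentialIdeal
        (extIdealSpan (oneForm '' (𝓔.dualAnnihilator : Set (Module.Dual R A)))) ↔
      ∀ s ∈ 𝓔, ∀ t ∈ 𝓔, L.bracket s t ∈ 𝓔 := by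
  refine ⟨fun hI s hs t ht => ?_, fun h𝓔 => ?_⟩
  · have h := fun θ (hθ : θ ∈ 𝓔.dualAnnihilator) =>
      L.apply_bracket_eq_zero_of_isDifferentialIdeal hI hs ht hθ
    exact mem_of_forall_dualAnnihilator h
  · rw [extIdealSpan_dualAnnihilator]
    exact ⟨isExtIdeal_vanishingForms 𝓔, fun _ => L.extDiff_mem_vanishingForms h𝓔⟩

end GenLieAlgebra

end ExteriorForms

section ProjectiveQuotient

theorem projective_quotient_of_isProj {R A : Type*} [Ring R] [AddCommGroup A] [Module R A]
    [Module.Projective R A] {S : Submodule R A} {f : Module.End R A} (hf : LinearMap.IsProj S f) :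
    Module.Projective R (A ⧸ S) := by
  refine .of_split (S.liftQ (LinearMap.id - f) fun z hz => ?_) S.mkQ ?_
  · simp [hf.map_id z hz]
  · ext z
    simp [hf.map_mem z]

end ProjectiveQuotient

section OrthogonalProjection

open ContinuousLinearMap

theorem starProjection_range_eq {𝕜 F G : Type*} [RCLike 𝕜] [NormedAddCommGroup F]
    [InnerProductSpace 𝕜 F] [CompleteSpace F] [NormedAddCommGroup G] [InnerProductSpace 𝕜 G]
    [CompleteSpace G] {T : F →L[𝕜] G} [T.range.HasOrthogonalProjection]
    (hT : (adjoint T ∘L T).IsInvertible) :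
    T.range.starProjection = T ∘L (adjoint T ∘L T).inverse ∘L adjoint T := by
  ext w
  refine Submodule.eq_starProjection_of_mem_of_inner_eq_zero (LinearMap.mem_range_self _ _) ?_
  rintro _ ⟨v, rfl⟩
  have hw : adjoint T (T ((adjoint T ∘L T).inverse (adjoint T w))) = adjoint T w :=
    hT.self_apply_inverse _
  simp [← adjoint_inner_left, hw]

variable {F G : Type*} [NormedAddCommGroup F] [InnerProductSpace ℝ F]
  [NormedAddCommGroup G] [InnerProductSpace ℝ G] [CompleteSpace G]

theorem contDiff_adjoint [CompleteSpace F] {n : WithTop ℕ∞} :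
    ContDiff ℝ n (adjoint : (F →L[ℝ] G) → G →L[ℝ] F) :=
  IsBoundedLinearMap.contDiff
    { map_add := map_add adjoint
      map_smul := map_smulₛₗ adjoint
      bound := ⟨1, one_pos, fun T => by
        simp only [LinearIsometryEquiv.norm_map, one_mul, le_refl]⟩ }

theorem isInvertible_adjoint_comp_self [FiniteDimensional ℝ F] {T : F →L[ℝ] G}
    (hT : Function.Injective T) : (adjoint T ∘L T).IsInvertible := by
  have hinj : Function.Injective (adjoint T ∘L T) :=
    LinearMap.ker_eq_bot.1 (T.ker_adjoint_comp_self.trans (LinearMap.ker_eq_bot.2 hT))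
  exact ⟨(LinearEquiv.ofInjectiveEndo _ hinj).toContinuousLinearEquiv, rfl⟩

theorem contDiffAt_starProjection_range [FiniteDimensional ℝ F] {n : WithTop ℕ∞} {T : F →L[ℝ] G}
    (hT : Function.Injective T) :
    ContDiffAt ℝ n (fun S : F →L[ℝ] G => S.range.starProjection) T := by
  have hcomp (k : WithTop ℕ∞) : ContDiff ℝ k fun S : F →L[ℝ] G => adjoint S ∘L S :=
    contDiff_adjoint.clm_comp contDiff_id
  obtain ⟨e, he⟩ := isInvertible_adjoint_comp_self hT
  have he_nhds : ∀ᶠ S in 𝓝 (adjoint T ∘L T), S.IsInvertible := he ▸ e.nhds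
  have hnhds : ∀ᶠ S in 𝓝 T, (adjoint S ∘L S).IsInvertible :=
    (hcomp 0).continuous.continuousAt.eventually he_nhds
  have he_inv : ContDiffAt ℝ n inverse (adjoint T ∘L T) := he ▸ contDiffAt_map_inverse e
  have hinv : ContDiffAt ℝ n (fun S : F →L[ℝ] G => (adjoint S ∘L S).inverse) T :=
    ContDiffAt.comp (f := fun S => adjoint S ∘L S) T he_inv (hcomp n).contDiffAt
  refine (contDiffAt_id.clm_comp (hinv.clm_comp contDiff_adjoint.contDiffAt)).congr_of_eventuallyEq
    ?_
  filter_upwards [hnhds] with S hS using starProjection_range_eq hS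

end OrthogonalProjection

section EuclideanCombination

variable {ι G : Type*} [Fintype ι] [NormedAddCommGroup G] [NormedSpace ℝ G]

/-- The linear map sending the standard basis of a Euclidean space to the family `w`. -/
noncomputable def euclideanCombination (w : ι → G) : EuclideanSpace ℝ ι →L[ℝ] G :=
  ∑ i, (EuclideanSpace.proj i : EuclideanSpace ℝ ι →L[ℝ] ℝ).smulRight (w i)

theorem euclideanCombination_apply (w : ι → G) (c : EuclideanSpace ℝ ι) :
    euclideanCombination w c = ∑ i, c i • w i := by
  simp [euclideanCombination]

theorem injective_euclideanCombination {w : ι → G} (hw : LinearIndependent ℝ w) :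
    Function.Injective (euclideanCombination w) := by
  have h : ⇑(euclideanCombination w) = Fintype.linearCombination ℝ w ∘ WithLp.ofLp := by
    ext c
    rw [euclideanCombination_apply]
    rfl
  rw [h]
  exact hw.fintypeLinearCombination_injective.comp (WithLp.ofLp_injective 2)

theorem range_euclideanCombination (w : ι → G) :
    (euclideanCombination w).range = Submodule.span ℝ (Set.range w) := by
  have h : (euclideanCombination w : EuclideanSpace ℝ ι →ₗ[ℝ] G) =
      Fintype.linearCombination ℝ w ∘ₗ (WithLp.linearEquiv 2 ℝ (ι → ℝ)) := by
    ext c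
    simp [euclideanCombination_apply, Fintype.linearCombination_apply]
  rw [h, LinearMap.range_comp, LinearEquiv.range, Submodule.map_top,
    Fintype.range_linearCombination]

theorem contDiff_euclideanCombination {n : WithTop ℕ∞} :
    ContDiff ℝ n (euclideanCombination : (ι → G) → EuclideanSpace ℝ ι →L[ℝ] G) := by
  unfold euclideanCombination
  fun_prop

end EuclideanCombination

section FrameCoordinates

open Bundle

variable {EB HB : Type*} [NormedAddCommGroup EB] [NormedSpace ℝ EB] [TopologicalSpace HB]
  {I : ModelWithCorners ℝ EB HB} {B : Type*} [TopologicalSpace B] [ChartedSpace HB B]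
  {K : Type*} [NormedAddCommGroup K] [NormedSpace ℝ K]
  {V : B → Type*} [TopologicalSpace (TotalSpace K V)] [∀ x, AddCommGroup (V x)]
  [∀ x, Module ℝ (V x)] [∀ x, TopologicalSpace (V x)] [FiberBundle K V]
  {k : WithTop ℕ∞} {ι : Type*} [Fintype ι] {s : ι → ∀ x, V x}

/-- The coordinates of a vector of a fibre in a global frame, valued in Euclidean space so as to
provide the fibre with the metric in which the frame is orthonormal. -/
noncomputable def frameCoord (hs : IsLocalFrameOn I K k s Set.univ) (x : B) :
    V x ≃ₗ[ℝ] EuclideanSpace ℝ ι :=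
  (hs.toBasisAt (Set.mem_univ x)).equivFun ≪≫ₗ (WithLp.linearEquiv 2 ℝ (ι → ℝ)).symm

theorem frameCoord_symm_apply (hs : IsLocalFrameOn I K k s Set.univ) (x : B)
    (c : EuclideanSpace ℝ ι) : (frameCoord hs x).symm c = ∑ i, c i • s i x := by
  simp [frameCoord, Module.Basis.equivFun_symm_apply]

variable [VectorBundle ℝ K V]

theorem contMDiffAt_frameCoord_symm (hs : IsLocalFrameOn I K k s Set.univ)
    {c : B → EuclideanSpace ℝ ι} {x : B} (hc : CMDiffAt k c x) :
    CMDiffAt k (T% fun y => (frameCoord hs y).symm (c y)) x := by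
  simp only [frameCoord_symm_apply]
  refine .sum_section fun i _ => .smul_section ?_ (hs.contMDiffAt isOpen_univ (Set.mem_univ x) i)
  exact (EuclideanSpace.proj (𝕜 := ℝ) i).contMDiff.contMDiffAt.comp x hc

variable [ContMDiffVectorBundle k K V I]

theorem contMDiffAt_frameCoord (hs : IsLocalFrameOn I K k s Set.univ) {z : ∀ x, V x} {x : B}
    (hz : CMDiffAt k (T% z) x) : CMDiffAt k (fun y => frameCoord hs y (z y)) x := by
  set e := trivializationAt K V x
  have hx : x ∈ e.baseSet := mem_baseSet_trivializationAt K V x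
  let A : B → EuclideanSpace ℝ ι →L[ℝ] K := fun y => euclideanCombination fun i => (e ⟨y, s i y⟩).2
  have hA : CMDiffAt k A x := by
    have hs' : ContMDiffAt I 𝓘(ℝ, ι → K) k (fun y i => (e ⟨y, s i y⟩).2) x :=
      contMDiffAt_pi_space.2 fun i =>
      (e.contMDiffAt_section_iff hx).1 (hs.contMDiffAt isOpen_univ (Set.mem_univ x) i)
    exact (contDiff_euclideanCombination (ι := ι) (G := K)).contMDiff.contMDiffAt.comp x hs'
  let R (y) (hy : y ∈ e.baseSet) : EuclideanSpace ℝ ι ≃L[ℝ] K :=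
    ((frameCoord hs y).symm ≪≫ₗ e.linearEquivAt ℝ y hy).toContinuousLinearEquiv
  have hAR (y) (hy : y ∈ e.baseSet) : A y = R y hy := by
    ext1 c
    change _ = e.linearEquivAt ℝ y hy ((frameCoord hs y).symm c)
    rw [frameCoord_symm_apply, map_sum, euclideanCombination_apply]
    simp
  have hinv : CMDiffAt k (fun y => (A y).inverse) x := by
    have h : ContDiffAt ℝ k ContinuousLinearMap.inverse (A x) :=
      hAR x hx ▸ contDiffAt_map_inverse (R x hx)
    exact h.contMDiffAt.comp x hA
  refine (hinv.clm_apply ((e.contMDiffAt_section_iff hx).1 hz)).congr_of_eventuallyEq ?_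
  filter_upwards [e.open_baseSet.mem_nhds hx] with y hy
  rw [hAR y hy, ContinuousLinearMap.inverse_equiv, ContinuousLinearEquiv.coe_coe,
    ContinuousLinearEquiv.eq_symm_apply]
  change e.linearEquivAt ℝ y hy ((frameCoord hs y).symm (frameCoord hs y (z y))) = _
  rw [LinearEquiv.symm_apply_apply]
  rfl

end FrameCoordinates

section FrameProjection

open Bundle

variable {n : ℕ} {B : Type*} [TopologicalSpace B] [ChartedSpace (EuclideanSpace ℝ (Fin n)) B]
  {K : Type*} [NormedAddCommGroup K] [NormedSpace ℝ K]
  {V : B → Type*} [TopologicalSpace (TotalSpace K V)] [∀ x, AddCommGroup (V x)]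
  [∀ x, Module ℝ (V x)] [∀ x, TopologicalSpace (V x)] [FiberBundle K V]
  {ι : Type*} [Fintype ι] {s : ι → ∀ x, V x}

/-- The orthogonal projection onto the fibres of a subbundle, for the Euclidean metric in which
the frame `s` is orthonormal. -/
noncomputable def Subbundle.fiberProjection (E : Subbundle n K V)
    (hs : IsLocalFrameOn (𝓡 n) K ∞ s Set.univ) (x : B) : V x →ₗ[ℝ] V x :=
  (frameCoord hs x).symm.conj ((E.fiber x).map (frameCoord hs x).toLinearMap).starProjection

theorem Subbundle.isProj_fiberProjection (E : Subbundle n K V)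
    (hs : IsLocalFrameOn (𝓡 n) K ∞ s Set.univ) (x : B) :
    LinearMap.IsProj (E.fiber x) (E.fiberProjection hs x) := by
  set E' := (E.fiber x).map (frameCoord hs x).toLinearMap
  refine ⟨fun v => ?_, fun v hv => ?_⟩
  · obtain ⟨w, hw, hwv⟩ := E'.starProjection_apply_mem (frameCoord hs x v)
    refine (Eq.symm ?_ : E.fiberProjection hs x v = w) ▸ hw
    exact (LinearEquiv.eq_symm_apply _).2 hwv
  · have hv' : frameCoord hs x v ∈ E' := Submodule.mem_map_of_mem hv
    exact (LinearEquiv.symm_apply_eq _).2 (Submodule.starProjection_eq_self_iff.2 hv')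

variable [VectorBundle ℝ K V] [ContMDiffVectorBundle ∞ K V (𝓡 n)]

/-- The basis of the module of smooth sections given by a global frame. -/
noncomputable def frameBasis (hs : IsLocalFrameOn (𝓡 n) K ∞ s Set.univ) :
    Module.Basis ι C^∞⟮𝓡 n, B; 𝓘(ℝ, ℝ), ℝ⟯ Cₛ^∞⟮𝓡 n; K, V⟯ :=
  .ofEquivFun
    { toFun z i := ⟨fun x => frameCoord hs x (z x) i, fun x =>
        (EuclideanSpace.proj (𝕜 := ℝ) i).contMDiff.contMDiffAt.comp x
          (contMDiffAt_frameCoord hs (z.contMDiff x))⟩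
      invFun c := ⟨fun x => (frameCoord hs x).symm (.toLp 2 fun i => c i x), fun x =>
        contMDiffAt_frameCoord_symm hs
          ((PiLp.contDiff_toLp (𝕜 := ℝ)).contMDiff.contMDiffAt.comp x
            (contMDiffAt_pi_space.2 fun i => (c i).contMDiff x))⟩
      map_add' z w := by
        ext i x
        exact congrArg (· i) (map_add (frameCoord hs x) (z x) (w x))
      map_smul' f z := by
        ext i x
        exact congrArg (· i) (map_smul (frameCoord hs x) (f x) (z x))
      left_inv z := by
        ext x
        exact (frameCoord hs x).symm_apply_apply (z x)
      right_inv c := by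
        ext i x
        exact congrArg (· i) ((frameCoord hs x).apply_symm_apply _) }

theorem Subbundle.contMDiff_starProjection_map_frameCoord (E : Subbundle n K V)
    (hs : IsLocalFrameOn (𝓡 n) K ∞ s Set.univ) :
    ContMDiff (𝓡 n) 𝓘(ℝ, EuclideanSpace ℝ ι →L[ℝ] EuclideanSpace ℝ ι) ∞ fun x =>
      ((E.fiber x).map (frameCoord hs x).toLinearMap).starProjection := by
  intro x
  obtain ⟨W, hW, hx, r, f, hf, hspan⟩ := E.exists_frame x
  let C : B → EuclideanSpace ℝ (Fin r) →L[ℝ] EuclideanSpace ℝ ι := fun y =>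
    euclideanCombination fun j => frameCoord hs y (f j y)
  have hC : ContMDiffAt (𝓡 n) 𝓘(ℝ, EuclideanSpace ℝ (Fin r) →L[ℝ] EuclideanSpace ℝ ι) ∞ C x := by
    have hf' : ContMDiffAt (𝓡 n) 𝓘(ℝ, Fin r → EuclideanSpace ℝ ι) ∞
        (fun y j => frameCoord hs y (f j y)) x :=
      contMDiffAt_pi_space.2 fun j =>
        contMDiffAt_frameCoord hs ((hf j).contMDiffAt (hW.mem_nhds hx))
    exact (contDiff_euclideanCombination
      (ι := Fin r) (G := EuclideanSpace ℝ ι)).contMDiff.contMDiffAt.comp x hf'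
  have hCx : Function.Injective (C x) := injective_euclideanCombination
    ((hspan x hx).1.map' (frameCoord hs x).toLinearMap (LinearEquiv.ker _))
  refine ((contDiffAt_starProjection_range hCx).contMDiffAt.comp x hC).congr_of_eventuallyEq ?_
  filter_upwards [hW.mem_nhds hx] with y hy
  have hrange : (E.fiber y).map (frameCoord hs y).toLinearMap = (C y).range := by
    rw [range_euclideanCombination, ← (hspan y hy).2, Submodule.map_span, ← Set.range_comp]
    rfl
  simp only [hrange, Function.comp_apply]

theorem Subbundle.contMDiff_fiberProjection (E : Subbundle n K V)
    (hs : IsLocalFrameOn (𝓡 n) K ∞ s Set.univ) (z : Cₛ^∞⟮𝓡 n; K, V⟯) :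
    ContMDiff (𝓡 n) ((𝓡 n).prod 𝓘(ℝ, K)) ∞
      fun x => (⟨x, E.fiberProjection hs x (z x)⟩ : TotalSpace K V) := fun x =>
  contMDiffAt_frameCoord_symm hs
    ((E.contMDiff_starProjection_map_frameCoord hs x).clm_apply
      (contMDiffAt_frameCoord hs (z.contMDiff x)))

theorem Subbundle.exists_isProj_sections {ι : Type*} [Finite ι] {s : ι → ∀ x, V x}
    (E : Subbundle n K V) (hs : IsLocalFrameOn (𝓡 n) K ∞ s Set.univ) :
    ∃ f : Module.End C^∞⟮𝓡 n, B; 𝓘(ℝ, ℝ), ℝ⟯ Cₛ^∞⟮𝓡 n; K, V⟯, LinearMap.IsProj E.sections f :=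
  have := Fintype.ofFinite ι
  ⟨{ toFun z := ⟨fun x => E.fiberProjection hs x (z x), E.contMDiff_fiberProjection hs z⟩
     map_add' z w := ContMDiffSection.ext fun x => map_add (E.fiberProjection hs x) (z x) (w x)
     map_smul' c z := ContMDiffSection.ext fun x =>
       map_smul (E.fiberProjection hs x) (c x) (z x) },
    fun z x => (E.isProj_fiberProjection hs x).map_mem (z x),
    fun _ hz => ContMDiffSection.ext fun x => (E.isProj_fiberProjection hs x).map_id _ (hz x)⟩

end FrameProjection

section Restriction

open Bundle

variable {n : ℕ} {B : Type*} [TopologicalSpace B] [ChartedSpace (EuclideanSpace ℝ (Fin n)) B]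
  {K : Type*} [NormedAddCommGroup K] [NormedSpace ℝ K]
  {V : B → Type*} [TopologicalSpace (TotalSpace K V)] [∀ x, TopologicalSpace (V x)]

theorem contMDiffOn_pullback_inclMap [∀ x, Zero (V x)] [FiberBundle K V] {W : Set B} {z : ∀ x, V x}
    (hW : IsOpen W)
    (hz : ContMDiffOn (𝓡 n) ((𝓡 n).prod 𝓘(ℝ, K)) ∞ (fun x => (⟨x, z x⟩ : TotalSpace K V)) W)
    (U : TopologicalSpace.Opens B) :
    ContMDiffOn (𝓡 n) ((𝓡 n).prod 𝓘(ℝ, K)) ∞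
      (fun x : U => (⟨x, z x.1⟩ : TotalSpace K (inclMap n B U *ᵖ V))) (Subtype.val ⁻¹' W) :=
  fun x hx => ((contMDiffAt_pullback_iff (inclMap n B U) (fun x => z x.1) x).2
    ((hz.contMDiffAt (hW.mem_nhds hx)).comp x (contMDiff_subtype_val x))).contMDiffWithinAt

variable [∀ x, AddCommGroup (V x)] [∀ x, Module ℝ (V x)] [FiberBundle K V]

theorem isLocalFrameOn_pullback_inclMap {ι : Type*} {s : ι → ∀ x, V x}
    {U : TopologicalSpace.Opens B} (hs : IsLocalFrameOn (𝓡 n) K ∞ s U) :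
    IsLocalFrameOn (𝓡 n) K ∞ (V := inclMap n B U *ᵖ V) (fun i x => s i x.1) Set.univ where
  linearIndependent {x} _ := hs.linearIndependent x.2
  generating {x} _ := hs.generating x.2
  contMDiffOn i := by
    have h := contMDiffOn_pullback_inclMap U.isOpen (hs.contMDiffOn i) U
    rwa [Subtype.coe_preimage_self] at h

/-- The restriction of a subbundle to an open set. -/
def Subbundle.restrict (E : Subbundle n K V) (U : TopologicalSpace.Opens B) :
    Subbundle n K (inclMap n B U *ᵖ V) where
  fiber x := E.fiber x.1
  exists_frame x₀ := by
    obtain ⟨W, hW, hx₀, r, s, hs, hspan⟩ := E.exists_frame x₀.1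
    exact ⟨Subtype.val ⁻¹' W, hW.preimage continuous_subtype_val, hx₀, r, fun i x => s i x.1,
      fun i => contMDiffOn_pullback_inclMap hW (hs i) U, fun x hx => hspan x.1 hx⟩

variable [VectorBundle ℝ K V]

theorem Subbundle.sections_restrict (E : Subbundle n K V) (U : TopologicalSpace.Opens B) :
    (E.restrict U).sections = E.sectionsOn U := rfl

variable [ContMDiffVectorBundle ∞ K V (𝓡 n)] {ι : Type*} [Finite ι] {s : ι → ∀ x, V x}
  {U : TopologicalSpace.Opens B}

theorem Subbundle.finite_quotient_sectionsOn (E : Subbundle n K V)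
    (hs : IsLocalFrameOn (𝓡 n) K ∞ s U) :
    Module.Finite C^∞⟮𝓡 n, U; 𝓘(ℝ, ℝ), ℝ⟯
      (Cₛ^∞⟮𝓡 n; K, inclMap n B U *ᵖ V⟯ ⧸ E.sectionsOn U) :=
  have := Fintype.ofFinite ι
  have := Module.Finite.of_basis (frameBasis (isLocalFrameOn_pullback_inclMap hs))
  inferInstance

theorem Subbundle.projective_quotient_sectionsOn (E : Subbundle n K V)
    (hs : IsLocalFrameOn (𝓡 n) K ∞ s U) :
    Module.Projective C^∞⟮𝓡 n, U; 𝓘(ℝ, ℝ), ℝ⟯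
      (Cₛ^∞⟮𝓡 n; K, inclMap n B U *ᵖ V⟯ ⧸ E.sectionsOn U) := by
  have := Fintype.ofFinite ι
  have hs' := isLocalFrameOn_pullback_inclMap hs
  have := Module.Projective.of_basis (frameBasis hs')
  obtain ⟨f, hf⟩ := (E.restrict U).exists_isProj_sections hs'
  rw [E.sections_restrict] at hf
  exact projective_quotient_of_isProj hf

end Restriction

section Involutive

variable {n : ℕ} {B : Type*} [TopologicalSpace B] [ChartedSpace (EuclideanSpace ℝ (Fin n)) B]
  [IsManifold (𝓡 n) ∞ B] [T2Space B]
  {K : Type*} [NormedAddCommGroup K] [NormedSpace ℝ K]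
  {V : B → Type*} [TopologicalSpace (Bundle.TotalSpace K V)] [∀ x, AddCommGroup (V x)]
  [∀ x, Module ℝ (V x)] [∀ x, TopologicalSpace (V x)] [FiberBundle K V] [VectorBundle ℝ K V]
  [ContMDiffVectorBundle ∞ K V (𝓡 n)]

/-- The restriction of a global section to an open set. -/
noncomputable def restrictSection (U : TopologicalSpace.Opens B) (S : Cₛ^∞⟮𝓡 n; K, V⟯) :
    Cₛ^∞⟮𝓡 n; K, inclMap n B U *ᵖ V⟯ :=
  ⟨fun x => S x.1, contMDiff_pullback_of_germs U _ fun _ =>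
    ⟨S, Filter.Eventually.of_forall fun _ => rfl⟩⟩

theorem Subbundle.exists_extend_section_mem (E : Subbundle n K V) (U : TopologicalSpace.Opens B)
    {s : Cₛ^∞⟮𝓡 n; K, inclMap n B U *ᵖ V⟯} (hs : s ∈ E.sectionsOn U) (x : U) :
    ∃ T ∈ E.sections, ∀ᶠ y in 𝓝 x, T y.1 = s y := by
  obtain ⟨T, hT⟩ := exists_extend_section U s x
  have hE : ∀ᶠ y in 𝓝 x.1, T y ∈ E.fiber y := by
    refine (eventually_opens_iff U x fun y => T y ∈ E.fiber y).1 ?_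
    filter_upwards [hT] with y hy
    rw [hy]
    exact hs y
  obtain ⟨χ, hχ, hχE⟩ := exists_bump (n := n) x.1 hE
  refine ⟨χ • T, fun y => ?_, ?_⟩
  · rw [section_smul_apply]
    by_cases hy : y ∈ tsupport χ
    · exact Submodule.smul_mem _ _ (hχE hy)
    · rw [image_eq_zero_of_notMem_tsupport hy, zero_smul]
      exact Submodule.zero_mem _
  · filter_upwards [hT, (eventually_opens_iff U x fun y => χ y = 1).2 hχ] with y hy hχy
    rw [section_smul_apply, hχy, one_smul, hy]

theorem Subbundle.bracket_mem_sections_iff (E : Subbundle n K V)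
    (L : GenLieAlgebra C^∞⟮𝓡 n, B; 𝓘(ℝ, ℝ), ℝ⟯ Cₛ^∞⟮𝓡 n; K, V⟯)
    {𝒰 : Set (TopologicalSpace.Opens B)} (h𝒰 : ∀ x, ∃ U ∈ 𝒰, x ∈ U) :
    (∀ S ∈ E.sections, ∀ T ∈ E.sections, L.bracket S T ∈ E.sections) ↔
      ∀ U ∈ 𝒰, ∀ s ∈ E.sectionsOn U, ∀ t ∈ E.sectionsOn U,
        (L.restrict U).bracket s t ∈ E.sectionsOn U := by
  refine ⟨fun h U _ s hs t ht x => ?_, fun h S hS T hT x => ?_⟩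
  · obtain ⟨S, hS, hSs⟩ := E.exists_extend_section_mem U hs x
    obtain ⟨T, hT, hTt⟩ := E.exists_extend_section_mem U ht x
    have hbracket : (L.restrict U).bracket s t x = L.bracket S T x.1 :=
      L.restrictBracket_eq U s t hSs hTt
    exact hbracket ▸ h S hS T hT x.1
  · obtain ⟨U, hU, hx⟩ := h𝒰 x
    have hbracket : (L.restrict U).bracket (restrictSection U S) (restrictSection U T) ⟨x, hx⟩ =
        L.bracket S T x :=
      L.restrictBracket_eq U _ _ (x := ⟨x, hx⟩) (.of_forall fun _ => rfl) (.of_forall fun _ => rfl)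
    exact hbracket ▸ h U hU _ (fun y => hS y.1) _ (fun y => hT y.1) ⟨x, hx⟩

end Involutive

theorem mainTheorem10_general {m n : ℕ} {M N : Type*} [TopologicalSpace M] [T2Space M]
    [ChartedSpace (EuclideanSpace ℝ (Fin m)) M] [IsManifold (𝓡 m) ∞ M] [TopologicalSpace N]
    [T2Space N] [ChartedSpace (EuclideanSpace ℝ (Fin n)) N] [IsManifold (𝓡 n) ∞ N]
    {K : Type*} [NormedAddCommGroup K] [NormedSpace ℝ K]
    {F : N → Type*} [TopologicalSpace (Bundle.TotalSpace K F)] [∀ y, AddCommGroup (F y)]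
    [∀ y, Module ℝ (F y)] [∀ y, TopologicalSpace (F y)] [FiberBundle K F] [VectorBundle ℝ K F]
    [ContMDiffVectorBundle ∞ K F (𝓡 n)] (𝔉 : GenLieAlgebroid m n M N K F)
    (E : 𝔉.InteriorSystem) {𝒰 : Set (TopologicalSpace.Opens M)}
    (hcover : ∀ x : M, ∃ U ∈ 𝒰, x ∈ U)
    (htriv : ∀ U ∈ 𝒰, ∃ (q : ℕ) (s : Fin q → ∀ x : M, (𝔉.hMap *ᵖ F) x),
      IsLocalFrameOn (𝓡 m) K ∞ s U) :
    𝔉.IsInvolutive E ↔ ∀ U ∈ 𝒰, 𝔉.IsExteriorSystemOn U (E.annihilatorIdealOn U) := by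
  refine (E.bracket_mem_sections_iff 𝔉.pullBack hcover).trans (forall₂_congr fun U hU => ?_)
  obtain ⟨q, s, hs⟩ := htriv U hU
  have := E.finite_quotient_sectionsOn hs
  have := E.projective_quotient_sectionsOn hs
  have hvanish := extIdealSpan_dualAnnihilator_le_vanishingForms (E.sectionsOn U)
  refine (𝔉.pullBack.restrict U).isDifferentialIdeal_extIdealSpan_dualAnnihilator_iff.symm.trans
    ⟨fun hI => ⟨hI, E, fun k _ θ hθ => ?_⟩, fun hI => hI.1⟩
  exact ofDegree_mem_vanishingForms.1 (hvanish hθ)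

theorem mainTheorem10 (m n p : ℕ) (M N : Type*)
    [TopologicalSpace M] [T2Space M] [ParacompactSpace M]
    [ChartedSpace (EuclideanSpace ℝ (Fin m)) M] [IsManifold (𝓡 m) ∞ M]
    [TopologicalSpace N] [T2Space N] [ParacompactSpace N]
    [ChartedSpace (EuclideanSpace ℝ (Fin n)) N] [IsManifold (𝓡 n) ∞ N]
    (F : N → Type*) [TopologicalSpace (Bundle.TotalSpace (EuclideanSpace ℝ (Fin p)) F)]
    [∀ y, AddCommGroup (F y)] [∀ y, Module ℝ (F y)] [∀ y, TopologicalSpace (F y)]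
    [FiberBundle (EuclideanSpace ℝ (Fin p)) F] [VectorBundle ℝ (EuclideanSpace ℝ (Fin p)) F]
    [ContMDiffVectorBundle ∞ (EuclideanSpace ℝ (Fin p)) F (𝓡 n)]
    (𝔉 : GenLieAlgebroid m n M N (EuclideanSpace ℝ (Fin p)) F)
    (E : 𝔉.InteriorSystem)
    (𝒜 : Set (OpenPartialHomeomorph M (EuclideanSpace ℝ (Fin m))))
    (h𝒜 : 𝒜 ⊆ IsManifold.maximalAtlas (𝓡 m) ∞ M)
    (hcover : ∀ x : M, ∃ ξ ∈ 𝒜, x ∈ ξ.source)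
    (htriv : ∀ ξ ∈ 𝒜, ∃ s : Fin p → ∀ x : M, (𝔉.hMap *ᵖ F) x,
      IsLocalFrameOn (𝓡 m) (EuclideanSpace ℝ (Fin p)) ∞ s ξ.source) :
    𝔉.IsInvolutive E ↔
      ∀ ξ ∈ 𝒜, 𝔉.IsExteriorSystemOn ⟨ξ.source, ξ.open_source⟩
        (E.annihilatorIdealOn ⟨ξ.source, ξ.open_source⟩) := by
  refine (mainTheorem10_general 𝔉 E (𝒰 := (fun ξ => ⟨ξ.source, ξ.open_source⟩) '' 𝒜) ?_ ?_).trans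
    Set.forall_mem_image
  · exact fun x => Set.exists_mem_image.2 (hcover x)
  · exact Set.forall_mem_image.2 fun ξ hξ => ⟨p, htriv ξ hξ⟩
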